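/- Let $m\ge 1$ be an integer. For functions of $r\in(0,\infty)$ write $\int f=2\pi\int_0^\infty f\,r\,dr$, $\|f\|_{L^2}^2=\int|f|^2$, and $$Q(r)=\sqrt8\,(m+1)\frac{r^m}{1+r^{2(m+1)}},\qquad A_\theta[u](r)=-\tfrac12\int_0^r|u|^2r'\,dr',\qquad D_+^{(u)}f=\partial_rf-\frac{m+A_\theta[u]}{r}f .$$ Let $L_Qf=D_+^{(Q)}f+\frac{Q}{r}\int_0^rQf\,r'\,dr'$ and $L_Q^*f=-\partial_rf-\frac{1+m+A_\theta[Q]}{r}f+Q\int_r^\infty Qf\,dr'$. Then there is a smooth real function $\rho$ on $(0,\infty)$ with $L_Q^*L_Q\rho=Q$, $L_Q\rho=\frac{1}{2(m+1)}rQ$ and $|\rho|\lesssim r^2Q$. Moreover, there exist $B>1$, $\eta^{**}>0$ and families $\{Q^{(\eta)}\}_{\eta\in[0,\eta^{**}]}$, $\{P^{(\eta)}\}_{\eta\in[0,\eta^{**}]}$ of smooth real-valued functions on $(0,\infty)$, with $P^{(\eta)}>0$ and $Q^{(\eta)}\in L^2$ (and hence $Q^{(\eta)}-Q\in L^2$),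 such that the following hold, where $R_\eta=(B\eta)^{-1/2}$ for $\eta>0$ and $R_0=+\infty$, where all implicit constants are independent of $\eta\in[0,\eta^{**}]$ and $r>0$, and where $o(\eta)$ refers to $\eta\to0^+$. 1. $D_+^{(Q^{(\eta)})}P^{(\eta)}=0$, $Q^{(\eta)}=e^{-\eta r^2/4}P^{(\eta)}$, and $Q^{(0)}=P^{(0)}=Q$. 2. For $\ell\in\{0,1\}$, $$|\partial_r^\ell Q^{(\eta)}(r)|\lesssim \mathbf 1_{r\le R_\eta}\,r^{-\ell}Q(r)+\mathbf 1_{r\ge R_\eta}\,R_\eta^{-\ell}Q(R_\eta)\,e^{-\eta r^2/4};$$ in particular $\sup_{\eta\in[0,\eta^{**}]}|\partial_r^\ell Q^{(\eta)}(r)|\lesssim r^{-\ell}Q(r)$. 3. $|Q^{(\eta)}-Q+\eta(m+1)\rho|\lesssim\eta^2r^4Q$ for all $0<r\le R_\eta$ (for all $0<r<\infty$ if $\eta=0$). 4. $\int|Q^{(\eta)}|^2=\int|Q|^2-\frac{\eta}{2(m+1)}\int|rQ|^2+o(\eta)$; in particular $\theta_\eta:=\frac1{4\pi}\int|Q^{(\eta)}|^2-(m+1)$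 satisfies $\theta_\eta=(m+1)-\frac{\eta}{8\pi(m+1)}\int|rQ|^2+o(\eta)$. 5. For every $\eta\in[0,\eta^{**}]$ the limit $\lim_{r\to\infty}\frac{\log P^{(\eta)}(r)}{\log r}$ exists, and it equals $-(m+2)+\frac{\eta}{8\pi(m+1)}\int|rQ|^2+o(\eta)$; in particular, for $0<\eta\le\eta^{**}$ it is larger than $-(m+2)$, i.e. $P^{(\eta)}$ decays more slowly than $Q$. 6. $\|Q^{(\eta)}-Q\|_{L^2}\lesssim\eta|\log\eta|^{1/2}$ if $m=1$ (the right side being $0$ at $\eta=0$), and $\|Q^{(\eta)}-Q\|_{L^2}\lesssim\eta$ if $m\ge2$. -/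

import Mathlib

open Set Filter Topology MeasureTheory Asymptotics
open scoped ContDiff

noncomputable section

namespace CSS

/-- The radial static profile `Q(r) = √8 (m+1) r^m / (1 + r^(2(m+1)))` of equivariance index `m`. -/
def Q (m : ℕ) (r : ℝ) : ℝ :=
  √8 * ((m : ℝ) + 1) * r ^ m / (1 + r ^ (2 * (m + 1)))

/-- The integral over the plane of a radial function: `2π ∫_0^∞ f(r) r dr`. -/
def planeIntegral (f : ℝ → ℝ) : ℝ :=
  2 * Real.pi * ∫ r in Ioi (0 : ℝ), f r * r

/-- A real radial profile is square integrable over the plane. -/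
def SquareIntegrable (f : ℝ → ℝ) : Prop :=
  IntegrableOn (fun r => |f r| ^ 2 * r) (Ioi (0 : ℝ))

/-- The `L²` norm over the plane of a real radial profile. -/
def l2norm (f : ℝ → ℝ) : ℝ :=
  √(planeIntegral fun r => |f r| ^ 2)

/-- The gauge potential `A_θ[u](r) = -(1/2) ∫_0^r |u|² r' dr'`. -/
def Atheta (u : ℝ → ℝ) (r : ℝ) : ℝ :=
  -(1 / 2) * ∫ s in (0 : ℝ)..r, |u s| ^ 2 * s

/-- The radial Bogomol'nyi operator `D_+^{(u)} f = ∂_r f - (m + A_θ[u]) / r · f`. -/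
def Dplus (m : ℕ) (u f : ℝ → ℝ) (r : ℝ) : ℝ :=
  deriv f r - ((m : ℝ) + Atheta u r) / r * f r

/-- Its formal `L²` adjoint `D_+^{(u)*} f = -∂_r f - (1 + m + A_θ[u]) / r · f`. -/
def DplusAdj (m : ℕ) (u f : ℝ → ℝ) (r : ℝ) : ℝ :=
  -deriv f r - (1 + (m : ℝ) + Atheta u r) / r * f r

/-- `B_f g = (1/r) ∫_0^r f g r' dr'` for real profiles. -/
def Bop (f g : ℝ → ℝ) (r : ℝ) : ℝ :=
  1 / r * ∫ s in (0 : ℝ)..r, f s * g s * s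

/-- The formal adjoint `B_w^* f = w ∫_r^∞ f dr'` for real profiles. -/
def BopAdj (w f : ℝ → ℝ) (r : ℝ) : ℝ :=
  w r * ∫ s in Ioi r, f s

/-- The linearized Bogomol'nyi operator `L_w = D_+^{(w)} + w B_w`. -/
def Lop (m : ℕ) (w f : ℝ → ℝ) (r : ℝ) : ℝ :=
  Dplus m w f r + w r * Bop w f r

/-- The formal adjoint `L_w^* f = D_+^{(w)*} f + B_w^* (w f)`. -/
def LopAdj (m : ℕ) (w f : ℝ → ℝ) (r : ℝ) : ℝ :=
  DplusAdj m w f r + BopAdj w (fun s => w s * f s) r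

/-- `ρ` is the generalized eigenmode: a smooth real function on `(0,∞)` with `L_Q^* L_Q ρ = Q`,
`L_Q ρ = r Q / (2(m+1))` and `|ρ| ≲ r² Q`. These conditions determine `ρ` on `(0,∞)`. -/
structure IsGeneralizedMode (m : ℕ) (ρ : ℝ → ℝ) : Prop where
  smooth : ContDiffOn ℝ ∞ ρ (Ioi 0)
  eqn : ∀ r > 0, LopAdj m (Q m) (Lop m (Q m) ρ) r = Q m r
  first_order : ∀ r > 0, Lop m (Q m) ρ r = 1 / (2 * ((m : ℝ) + 1)) * (r * Q m r)
  bound : ∃ C : ℝ, ∀ r > 0, |ρ r| ≤ C * (r ^ 2 * Q m r)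

/-- The radius `R_η = (B η)^(-1/2)`, used for `η > 0` (for `η = 0` it is `+∞`, see below). -/
def Rad (B η : ℝ) : ℝ := (B * η) ^ (-(1 / 2) : ℝ)

/-- The set of `r > 0` with `r ≤ R_η`, where `R_0 = +∞`. -/
def inner (B η : ℝ) : Set ℝ := {r | 0 < r ∧ (η = 0 ∨ r ≤ Rad B η)}

/-- The set of finite `r` with `r ≥ R_η`, where `R_0 = +∞`. -/
def outer (B η : ℝ) : Set ℝ := {r | 0 < η ∧ Rad B η ≤ r}

/-- `θ = (1/4π) ∫ |u|² - (m+1)`. -/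
def theta (m : ℕ) (u : ℝ → ℝ) : ℝ :=
  1 / (4 * Real.pi) * planeIntegral (fun r => |u r| ^ 2) - ((m : ℝ) + 1)

end CSS

end

/-!
Write `P^η = Q e^{φ/2}`, so that `|Q^η|² = Q² e^{φ - ηr²/2}`. Since `D_+^{(Q)} Q = 0`, the
equation `D_+^{(Q^η)} P^η = 0` becomes the radial Poisson equation `-Δφ = Q² (e^{φ - ηr²/2} - 1)`,
`φ(0) = 0`. With the exponential truncated above, its right side is Lipschitz in `φ` and a
contraction in an exponentially weighted space solves it. A Grönwall inequality weighted by the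
finite mass of `Q²` gives `|φ| ≲ ηr²`, hence `r φ' = O(η)` at infinity, and for small `η` the
truncation is never active. Linearizing in `η` gives the first variation of the exponent, and with
it `ρ`.

The angular density `a = m + A_θ[Q^η]` decreases from `m` to `-1 - θ_η`, which is therefore the
decay exponent of `P^η`. Moreover `2 (1 + a)² + r² |Q^η|² + η ∫_0^r s³ |Q^η|² ds` is constant in
`r`, and comparing its values at `0` and at infinity yields the Pohozaev identity
`2 θ_η² + η ∫_0^∞ r³ |Q^η|² dr = 2 (m + 1)²`, from which the expansions of the mass and of the
decay exponent follow.
-/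

noncomputable section

namespace CSS

section RadialPotential

/-- The radial mean `u⁻¹ ∫_0^u s b(s) ds` of a density `b`. The convention `0⁻¹ = 0` gives its
continuous extension to `u = 0`. -/
def radialMean (b : ℝ → ℝ) (u : ℝ) : ℝ := u⁻¹ * ∫ s in (0 : ℝ)..u, s * b s

/-- `f` is the radial solution of the Poisson equation `-Δf = b` in the plane that vanishes at the
origin, in the once integrated form `r f' = -∫_0^r s b(s) ds`. -/
structure IsRadialPotential (b f : ℝ → ℝ) : Prop where
  continuous : Continuous f
  zero : f 0 = 0
  hasDerivAt : ∀ r > 0, HasDerivAt f (-radialMean b r) r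

variable {b b' f f' g g' : ℝ → ℝ} {r : ℝ}

lemma radialMean_eq_mul_integral (b : ℝ → ℝ) (u : ℝ) :
    radialMean b u = u * ∫ σ in (0 : ℝ)..1, σ * b (u * σ) := by
  rcases eq_or_ne u 0 with rfl | hu
  · simp [radialMean]
  have hscale : ∫ σ in (0 : ℝ)..1, u * σ * b (u * σ) = radialMean b u := by
    rw [intervalIntegral.integral_comp_mul_left (fun s => s * b s) hu]
    simp [radialMean]
  rw [← hscale, ← intervalIntegral.integral_const_mul]
  simp only [mul_assoc]

lemma continuous_radialMean (hb : Continuous b) : Continuous (radialMean b) := by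
  simp only [funext (radialMean_eq_mul_integral b)]
  refine continuous_id.mul
    (intervalIntegral.continuous_parametric_intervalIntegral_of_continuous' ?_ 0 1)
  fun_prop

lemma radialMean_sub_const_mul (hb : Continuous b) (hb' : Continuous b') (c u : ℝ) :
    radialMean (fun s => b s - c * b' s) u = radialMean b u - c * radialMean b' u := by
  have hsplit : ∀ s, s * (b s - c * b' s) = s * b s - c * (s * b' s) := fun s => by ring
  simp only [radialMean, hsplit]
  rw [intervalIntegral.integral_sub, intervalIntegral.integral_const_mul]
  · ring
  all_goals exact Continuous.intervalIntegrable (by fun_prop) _ _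

lemma radialMean_congr (hr : 0 ≤ r) (h : ∀ s ∈ Icc 0 r, b s = b' s) :
    radialMean b r = radialMean b' r := by
  unfold radialMean
  congr 1
  refine intervalIntegral.integral_congr fun s hs => ?_
  simp only [h s (uIcc_of_le hr ▸ hs)]

lemma hasDerivAt_integral_zero (hb : Continuous b) (r : ℝ) :
    HasDerivAt (fun u => ∫ s in (0 : ℝ)..u, b s) (b r) r :=
  (hb.integral_hasStrictDerivAt 0 r).hasDerivAt

lemma abs_le_of_abs_deriv_le {a : ℝ} (hr : a ≤ r) (hf : ContinuousOn f (Icc a r))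
    (hg : ContinuousOn g (Icc a r)) (hf' : ∀ u ∈ Ioo a r, HasDerivAt f (f' u) u)
    (hg' : ∀ u ∈ Ioo a r, HasDerivAt g (g' u) u) (ha : |f a| ≤ g a)
    (h : ∀ u ∈ Ioo a r, |f' u| ≤ g' u) : |f r| ≤ g r := by
  have hl : a ∈ Icc a r := left_mem_Icc.2 hr
  have hrr : r ∈ Icc a r := right_mem_Icc.2 hr
  have hsub : MonotoneOn (fun u => g u - f u) (Icc a r) := by
    refine monotoneOn_of_hasDerivWithinAt_nonneg (convex_Icc _ _) (hg.sub hf)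
      (f' := fun u => g' u - f' u) ?_ ?_ <;> rw [interior_Icc] <;> intro u hu
    · exact ((hg' u hu).sub (hf' u hu)).hasDerivWithinAt
    · exact sub_nonneg.2 ((le_abs_self _).trans (h u hu))
  have hadd : MonotoneOn (fun u => g u + f u) (Icc a r) := by
    refine monotoneOn_of_hasDerivWithinAt_nonneg (convex_Icc _ _) (hg.add hf)
      (f' := fun u => g' u + f' u) ?_ ?_ <;> rw [interior_Icc] <;> intro u hu
    · exact ((hg' u hu).add (hf' u hu)).hasDerivWithinAt
    · linarith [neg_abs_le (f' u), h u hu]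
  have hle_sub := hsub hl hrr hr
  have hle_add := hadd hl hrr hr
  dsimp only at hle_sub hle_add
  rw [abs_le] at ha ⊢
  constructor <;> linarith

lemma abs_integral_le_of_abs_le_deriv (hr : 0 ≤ r) (hb : Continuous b)
    (hg : ∀ u, HasDerivAt g (g' u) u) (h0 : 0 ≤ g 0) (h : ∀ s ∈ Ioo 0 r, |b s| ≤ g' s) :
    |∫ s in (0 : ℝ)..r, b s| ≤ g r := by
  have hB := hasDerivAt_integral_zero hb
  exact abs_le_of_abs_deriv_le hr (HasDerivAt.continuousOn fun u _ => hB u)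
    (HasDerivAt.continuousOn fun u _ => hg u) (fun u _ => hB u) (fun u _ => hg u) (by simpa) h

namespace IsRadialPotential

lemma sub_const_mul (h : IsRadialPotential b f) (h' : IsRadialPotential b' f')
    (hb : Continuous b) (hb' : Continuous b') (c : ℝ) :
    IsRadialPotential (fun s => b s - c * b' s) (fun s => f s - c * f' s) where
  continuous := h.continuous.sub (h'.continuous.const_mul c)
  zero := by simp [h.zero, h'.zero]
  hasDerivAt r hr := by
    rw [radialMean_sub_const_mul hb hb']
    exact ((h.hasDerivAt r hr).sub ((h'.hasDerivAt r hr).const_mul c)).congr_deriv (by ring)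

lemma congr_source (h : IsRadialPotential b f) (hb : ∀ s, 0 ≤ s → b s = b' s) :
    IsRadialPotential b' f where
  continuous := h.continuous
  zero := h.zero
  hasDerivAt r hr :=
    (h.hasDerivAt r hr).congr_deriv (by rw [radialMean_congr hr.le fun s hs => hb s hs.1])

lemma abs_le_of_abs_integral_le (h : IsRadialPotential b f) (hr : 0 ≤ r)
    (hg : ∀ u, HasDerivAt g (g' u) u) (h0 : 0 ≤ g 0)
    (hbg : ∀ u ∈ Ioo 0 r, |∫ s in (0 : ℝ)..u, s * b s| ≤ u * g' u) : |f r| ≤ g r := by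
  refine abs_le_of_abs_deriv_le hr h.continuous.continuousOn
    (HasDerivAt.continuousOn fun u _ => hg u) (fun u hu => h.hasDerivAt u hu.1)
    (fun u _ => hg u) (by simpa [h.zero]) fun u hu => ?_
  rw [abs_neg, radialMean, abs_mul, abs_inv, abs_of_pos hu.1, inv_mul_le_iff₀ hu.1]
  exact hbg u hu

lemma abs_le_mul_pow (h : IsRadialPotential b f) (hb : Continuous b) {D : ℝ} {a : ℕ} (hr : 0 ≤ r)
    (hD : ∀ s ∈ Ioo 0 r, |b s| ≤ D * s ^ a) : |f r| ≤ D / (a + 2) ^ 2 * r ^ (a + 2) := by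
  have hpow : ∀ (c u : ℝ), HasDerivAt (fun u => c * u ^ (a + 2)) (c * ((a + 2) * u ^ (a + 1))) u :=
    fun c u => by simpa using (hasDerivAt_pow (a + 2) u).const_mul c
  refine h.abs_le_of_abs_integral_le hr (hpow _) (by simp) fun u hu => ?_
  have hmass := abs_integral_le_of_abs_le_deriv (b := fun s => s * b s) hu.1.le (by fun_prop)
    (hpow (D / (a + 2))) (by simp) fun s hs => ?_
  · refine hmass.trans_eq ?_
    field_simp
    ring
  · rw [abs_mul, abs_of_pos hs.1]
    calc s * |b s| ≤ s * (D * s ^ a) :=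
          mul_le_mul_of_nonneg_left (hD s ⟨hs.1, hs.2.trans hu.2⟩) hs.1.le
      _ = _ := by field_simp; ring

lemma exists_abs_le_mul_sq (h : IsRadialPotential b f) (hb : Continuous b) (r : ℝ) :
    ∃ A, 0 ≤ A ∧ ∀ s ∈ Icc 0 r, |f s| ≤ A * s ^ 2 := by
  obtain ⟨D, hD⟩ := (isCompact_Icc (a := 0) (b := r)).exists_bound_of_continuousOn hb.continuousOn
  have hD' : ∀ s ∈ Icc 0 r, |b s| ≤ max D 0 := fun s hs => (hD s hs).trans (le_max_left _ _)
  refine ⟨max D 0 / (0 + 2) ^ 2, by positivity, fun s hs => ?_⟩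
  simpa using h.abs_le_mul_pow hb (a := 0) hs.1 fun u hu => by
    simpa using hD' u ⟨hu.1.le, hu.2.le.trans hs.2⟩

lemma abs_le_mul_exp (h : IsRadialPotential b f) (hb : Continuous b) {D l : ℝ} (hl : 0 < l)
    (hr : 0 ≤ r) (hD : ∀ s, 0 ≤ s → |b s| ≤ D * Real.exp (l * s)) :
    |f r| ≤ D / l ^ 2 * Real.exp (l * r) := by
  have hD0 : 0 ≤ D := by simpa using (abs_nonneg _).trans (hD 0 le_rfl)
  have hexp : ∀ u, HasDerivAt (fun u => Real.exp (l * u)) (Real.exp (l * u) * l) u := fun u => by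
    simpa using ((hasDerivAt_id u).const_mul l).exp
  refine h.abs_le_of_abs_integral_le hr (fun u => (hexp u).const_mul _) (by positivity)
    fun u hu => ?_
  have hmass := abs_integral_le_of_abs_le_deriv (b := fun s => s * b s) hu.1.le (by fun_prop)
    (fun s => ((hasDerivAt_id s).mul (hexp s)).const_mul (D / l)) (by simp) fun s hs => ?_
  · refine hmass.trans_eq ?_
    simp only [id, Pi.mul_apply]
    field_simp
  · rw [abs_mul, abs_of_pos hs.1]
    calc s * |b s| ≤ s * (D * Real.exp (l * s)) :=
          mul_le_mul_of_nonneg_left (hD s hs.1.le) hs.1.le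
      _ ≤ D / l * Real.exp (l * s) + s * (D * Real.exp (l * s)) :=
          le_add_of_nonneg_left (by positivity)
      _ = _ := by simp only [id]; field_simp

lemma contDiffOn_succ (h : IsRadialPotential b f) (hb : Continuous b) {n : ℕ}
    (hbn : ContDiffOn ℝ n b (Ioi 0)) : ContDiffOn ℝ (n + 1 : ℕ) f (Ioi 0) := by
  have hmass := hasDerivAt_integral_zero (b := fun s => s * b s) (by fun_prop)
  have hmassn : ContDiffOn ℝ (n + 1 : ℕ) (fun u => ∫ s in (0 : ℝ)..u, s * b s) (Ioi 0) := by
    push_cast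
    rw [contDiffOn_succ_iff_deriv_of_isOpen isOpen_Ioi, funext fun u => (hmass u).deriv]
    exact ⟨fun u _ => (hmass u).differentiableAt.differentiableWithinAt, by simp,
      contDiffOn_id.mul hbn⟩
  have hmean : ContDiffOn ℝ n (fun u => -radialMean b u) (Ioi 0) :=
    ((contDiffOn_id.inv fun u hu => ne_of_gt hu).mul
      (hmassn.of_le (by exact_mod_cast n.le_succ))).neg
  push_cast
  rw [contDiffOn_succ_iff_deriv_of_isOpen isOpen_Ioi]
  exact ⟨fun u hu => (h.hasDerivAt u hu).differentiableAt.differentiableWithinAt, by simp,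
    hmean.congr fun u hu => (h.hasDerivAt u hu).deriv⟩

lemma contDiffOn_of_semilinear {N : ℝ → ℝ → ℝ}
    (h : IsRadialPotential (fun s => N s (f s)) f) (hN : ContDiff ℝ ∞ (Function.uncurry N)) :
    ContDiffOn ℝ ∞ f (Ioi 0) := by
  have hc : Continuous fun s => N s (f s) := hN.continuous.comp (continuous_id.prodMk h.continuous)
  rw [contDiffOn_infty]
  intro n
  induction n with
  | zero => exact contDiffOn_zero.2 h.continuous.continuousOn
  | succ n ih =>
    exact h.contDiffOn_succ hc
      ((hN.of_le (by exact_mod_cast le_top)).comp_contDiffOn (contDiffOn_id.prodMk ih))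

end IsRadialPotential

end RadialPotential

section SemilinearPoisson

open scoped NNReal BoundedContinuousFunction

/-- The solution operator `b ↦ f` of the radial Poisson problem `-Δf = b`, `f(0) = 0`. -/
def radialPotential (b : ℝ → ℝ) (r : ℝ) : ℝ := -∫ u in (0 : ℝ)..r, radialMean b u

lemma isRadialPotential_radialPotential {b : ℝ → ℝ} (hb : Continuous b) :
    IsRadialPotential b (radialPotential b) := by
  have hderiv : ∀ r, HasDerivAt (radialPotential b) (-radialMean b r) r := fun r =>
    (hasDerivAt_integral_zero (continuous_radialMean hb) r).neg
  exact ⟨continuous_iff_continuousAt.2 fun r => (hderiv r).continuousAt, by simp [radialPotential],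
    fun r _ => hderiv r⟩

/-- The density `s ↦ N(s, f(s))` of `f(s) = e^{ls} g(s)`: bounded `g` parametrize the functions
`f` that grow at most like `e^{ls}`. -/
def weightedSource (N : ℝ → ℝ → ℝ) (l : ℝ) (g : ℝ≥0 →ᵇ ℝ) (s : ℝ) : ℝ :=
  N s (Real.exp (l * s) * g s.toNNReal)

variable {N : ℝ → ℝ → ℝ} {K A : ℝ}

lemma continuous_weightedSource (hN : Continuous (Function.uncurry N)) (l : ℝ) (g : ℝ≥0 →ᵇ ℝ) :
    Continuous (weightedSource N l g) := by
  have := g.continuous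
  exact hN.comp (continuous_id.prodMk (by fun_prop))

lemma abs_weightedSource_sub_le {s : ℝ}
    (hK : ∀ x y, |N s x - N s y| ≤ K * |x - y|) (l : ℝ) (g₁ g₂ : ℝ≥0 →ᵇ ℝ) :
    |weightedSource N l g₁ s - weightedSource N l g₂ s| ≤ K * dist g₁ g₂ * Real.exp (l * s) := by
  have hK0 : 0 ≤ K := by simpa using (abs_nonneg _).trans (hK 1 0)
  refine (hK _ _).trans ?_
  rw [← mul_sub, abs_mul, Real.abs_exp, mul_assoc, mul_comm (dist g₁ g₂)]
  gcongr
  exact BoundedContinuousFunction.dist_coe_le_dist (f := g₁) (g := g₂) _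

lemma abs_weightedSource_le {s l : ℝ} (hl : 0 ≤ l) (hs : 0 ≤ s)
    (hK : ∀ x y, |N s x - N s y| ≤ K * |x - y|) (hA : |N s 0| ≤ A) (g : ℝ≥0 →ᵇ ℝ) :
    |weightedSource N l g s| ≤ (A + K * dist g 0) * Real.exp (l * s) := by
  have hdiff := abs_weightedSource_sub_le hK l g 0
  have hzero : weightedSource N l 0 s = N s 0 := by simp [weightedSource]
  have hA' : A ≤ A * Real.exp (l * s) :=
    le_mul_of_one_le_right ((abs_nonneg _).trans hA) (Real.one_le_exp (by positivity))
  rw [hzero] at hdiff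
  linarith [abs_sub_abs_le_abs_sub (weightedSource N l g s) (N s 0)]

/-- The Picard map `φ ↦ radialPotential (N(·, φ))`, conjugated by the weight `e^{ls}`. -/
def weightedPicard (N : ℝ → ℝ → ℝ) (l : ℝ) (g : ℝ≥0 →ᵇ ℝ) (r : ℝ≥0) : ℝ :=
  Real.exp (-(l * r)) * radialPotential (weightedSource N l g) r

lemma continuous_weightedPicard (hN : Continuous (Function.uncurry N)) (l : ℝ) (g : ℝ≥0 →ᵇ ℝ) :
    Continuous (weightedPicard N l g) := by
  have := (isRadialPotential_radialPotential (continuous_weightedSource hN l g)).continuous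
  unfold weightedPicard
  fun_prop

lemma abs_weightedPicard_le {l : ℝ} (hl : 0 < l) (hN : Continuous (Function.uncurry N))
    (hK : ∀ s, 0 ≤ s → ∀ x y, |N s x - N s y| ≤ K * |x - y|)
    (hA : ∀ s, 0 ≤ s → |N s 0| ≤ A) (g : ℝ≥0 →ᵇ ℝ) (r : ℝ≥0) :
    |weightedPicard N l g r| ≤ (A + K * dist g 0) / l ^ 2 := by
  have hsource := continuous_weightedSource hN l g
  rw [weightedPicard, abs_mul, Real.abs_exp, Real.exp_neg, inv_mul_le_iff₀ (Real.exp_pos _),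
    mul_comm]
  exact (isRadialPotential_radialPotential hsource).abs_le_mul_exp hsource hl r.2
    fun s hs => abs_weightedSource_le hl.le hs (hK s hs) (hA s hs) g

lemma abs_weightedPicard_sub_le {l : ℝ} (hl : 0 < l) (hN : Continuous (Function.uncurry N))
    (hK : ∀ s, 0 ≤ s → ∀ x y, |N s x - N s y| ≤ K * |x - y|) (g₁ g₂ : ℝ≥0 →ᵇ ℝ) (r : ℝ≥0) :
    |weightedPicard N l g₁ r - weightedPicard N l g₂ r| ≤ K * dist g₁ g₂ / l ^ 2 := by
  have hc₁ := continuous_weightedSource hN l g₁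
  have hc₂ := continuous_weightedSource hN l g₂
  have hsub := ((isRadialPotential_radialPotential hc₁).sub_const_mul
    (isRadialPotential_radialPotential hc₂) hc₁ hc₂ 1).abs_le_mul_exp (by fun_prop) hl r.2
    fun s hs => by simpa using abs_weightedSource_sub_le (hK s hs) l g₁ g₂
  rw [one_mul] at hsub
  rw [weightedPicard, weightedPicard, ← mul_sub, abs_mul, Real.abs_exp, Real.exp_neg,
    inv_mul_le_iff₀ (Real.exp_pos _), mul_comm]
  exact hsub

theorem exists_isRadialPotential_semilinear (hN : Continuous (Function.uncurry N))
    (hK : ∀ s, 0 ≤ s → ∀ x y, |N s x - N s y| ≤ K * |x - y|)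
    (hA : ∀ s, 0 ≤ s → |N s 0| ≤ A) : ∃ f, IsRadialPotential (fun s => N s (f s)) f := by
  have hK0 : 0 ≤ K := by simpa using (abs_nonneg _).trans (hK 0 le_rfl 1 0)
  have hl : 0 < 1 + K := by positivity
  let T : (ℝ≥0 →ᵇ ℝ) → (ℝ≥0 →ᵇ ℝ) := fun g =>
    BoundedContinuousFunction.ofNormedAddCommGroup (weightedPicard N (1 + K) g)
      (continuous_weightedPicard hN _ g) _ (abs_weightedPicard_le hl hN hK hA g)
  have hT : ContractingWith (1 / 4) T := by
    refine ⟨by rw [← NNReal.coe_lt_coe]; norm_num, LipschitzWith.of_dist_le_mul fun g₁ g₂ => ?_⟩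
    refine (BoundedContinuousFunction.dist_le (by positivity)).2 fun r =>
      (abs_weightedPicard_sub_le hl hN hK g₁ g₂ r).trans ?_
    rw [div_le_iff₀ (by positivity)]
    push_cast
    nlinarith [mul_nonneg (sq_nonneg (1 - K)) (dist_nonneg (x := g₁) (y := g₂))]
  obtain ⟨g, hg⟩ : ∃ g, T g = g := ⟨_, hT.fixedPoint_isFixedPt⟩
  have hsource := continuous_weightedSource hN (1 + K) g
  refine ⟨radialPotential (weightedSource N (1 + K) g),
    (isRadialPotential_radialPotential hsource).congr_source fun s hs => ?_⟩
  lift s to ℝ≥0 using hs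
  have hgs : Real.exp (-((1 + K) * s)) * radialPotential (weightedSource N (1 + K) g) s = g s :=
    DFunLike.congr_fun hg s
  rw [Real.exp_neg, inv_mul_eq_iff_eq_mul₀ (Real.exp_ne_zero _)] at hgs
  rw [hgs, weightedSource, Real.toNNReal_coe]

end SemilinearPoisson

section WeightedGronwall

variable {b f w : ℝ → ℝ} {r : ℝ}

lemma IsRadialPotential.abs_le_mul_pow_mul_exp (h : IsRadialPotential b f) (hb : Continuous b)
    (hw : Continuous w) {D k : ℝ} {a : ℕ} (ha : 1 ≤ a) (hD : 0 ≤ D) (hk : 0 < k) (hr : 0 ≤ r)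
    (hw0 : ∀ s, 0 ≤ w s)
    (hbw : ∀ s ∈ Ioo 0 r, |b s| ≤ D * w s * (s ^ a * Real.exp (k * ∫ t in (0 : ℝ)..s, t * w t))) :
    |f r| ≤ D / k * (r ^ a * Real.exp (k * ∫ t in (0 : ℝ)..r, t * w t)) := by
  have hE : ∀ u, HasDerivAt (fun u => Real.exp (k * ∫ t in (0 : ℝ)..u, t * w t))
      (Real.exp (k * ∫ t in (0 : ℝ)..u, t * w t) * (k * (u * w u))) u := fun u =>
    ((hasDerivAt_integral_zero (b := fun t => t * w t) (by fun_prop) u).const_mul k).exp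
  set E : ℝ → ℝ := fun u => Real.exp (k * ∫ t in (0 : ℝ)..u, t * w t)
  have hE0 : ∀ u, 0 < E u := fun u => Real.exp_pos _
  refine h.abs_le_of_abs_integral_le hr
    (fun u => ((hasDerivAt_pow a u).mul (hE u)).const_mul (D / k))
    (by simp only [Pi.mul_apply]; positivity) fun u hu => ?_
  have hmass : |∫ s in (0 : ℝ)..u, s * b s| ≤ D / k * u ^ a * E u := by
    refine abs_integral_le_of_abs_le_deriv hu.1.le (by fun_prop)
      (fun s => (hE s).const_mul (D / k * u ^ a))
      (by have := hu.1; have := hE0 0; positivity) fun s hs => ?_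
    have hs0 := hs.1
    have := hw0 s
    have := hE0 s
    rw [abs_mul, abs_of_pos hs.1]
    calc s * |b s| ≤ s * (D * w s * (u ^ a * E s)) := by
          gcongr
          exact (hbw s ⟨hs.1, hs.2.trans hu.2⟩).trans (by gcongr; exact hs.2.le)
      _ = _ := by field_simp; rfl
  refine hmass.trans ?_
  have hu0 : 0 < u := hu.1
  have := hw0 u
  have := hE0 u
  have ha' : (1 : ℝ) ≤ a := by exact_mod_cast ha
  calc D / k * u ^ a * E u ≤ a * (D / k * u ^ a * E u) := le_mul_of_one_le_left (by positivity) ha'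
    _ ≤ a * (D / k * u ^ a * E u) + D / k * u ^ a * E u * (k * (u * w u)) * u :=
      le_add_of_nonneg_right (by positivity)
    _ = _ := by
      obtain ⟨n, rfl⟩ : ∃ n, a = n + 1 := ⟨a - 1, by omega⟩
      rw [Nat.add_sub_cancel]
      ring

/-- A Grönwall inequality: the a priori constant `A` only makes the best constant in
`|f u| ≤ S u^a exp (2 L ∫_0^u t w)` finite, and does not enter the conclusion. -/
theorem IsRadialPotential.abs_le_of_abs_source_le (h : IsRadialPotential b f) (hb : Continuous b)
    (hw : Continuous w) (hw0 : ∀ s, 0 ≤ w s) {Λ L c A : ℝ} {a : ℕ} (ha : 1 ≤ a) (hL : 0 < L)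
    (hc : 0 ≤ c) (hr : 0 ≤ r) (hΛ : ∫ s in (0 : ℝ)..r, s * w s ≤ Λ)
    (hbw : ∀ s ∈ Ioc 0 r, |b s| ≤ w s * (L * |f s| + c * s ^ a))
    (hA : ∀ s ∈ Ioc 0 r, |f s| ≤ A * s ^ a) :
    |f r| ≤ c / L * Real.exp (2 * L * Λ) * r ^ a := by
  rcases hr.eq_or_lt with rfl | hr
  · simp [h.zero, show a ≠ 0 by omega]
  set q : ℝ → ℝ := fun u => u ^ a * Real.exp (2 * L * ∫ t in (0 : ℝ)..u, t * w t) with hq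
  have hpow_le : ∀ u, 0 < u → u ^ a ≤ q u := fun u hu =>
    le_mul_of_one_le_right (by positivity) (Real.one_le_exp (mul_nonneg (by positivity)
      (intervalIntegral.integral_nonneg hu.le fun t ht => mul_nonneg ht.1 (hw0 t))))
  have hq0 : ∀ u, 0 < u → 0 < q u := fun u hu => by positivity
  have hbdd : BddAbove ((fun u => |f u| / q u) '' Ioc 0 r) := by
    refine ⟨A, forall_mem_image.2 fun u hu => ?_⟩
    have hA0 : 0 ≤ A :=
      nonneg_of_mul_nonneg_left ((abs_nonneg _).trans (hA u hu)) (pow_pos hu.1 a)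
    rw [div_le_iff₀ (hq0 u hu.1)]
    exact (hA u hu).trans (by gcongr; exact hpow_le u hu.1)
  set S := sSup ((fun u => |f u| / q u) '' Ioc 0 r)
  have hS : ∀ u ∈ Ioc 0 r, |f u| ≤ S * q u := fun u hu =>
    (div_le_iff₀ (hq0 u hu.1)).1 (le_csSup hbdd (mem_image_of_mem _ hu))
  have hmem : r ∈ Ioc 0 r := right_mem_Ioc.2 hr
  have hS0 : 0 ≤ S :=
    nonneg_of_mul_nonneg_left ((abs_nonneg _).trans (hS r hmem)) (hq0 r hr)
  have himprove : ∀ u ∈ Ioc 0 r, |f u| ≤ (L * S + c) / (2 * L) * q u := fun u hu =>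
    h.abs_le_mul_pow_mul_exp hb hw ha (by positivity) (by positivity) hu.1.le hw0 fun s hs => by
      have hs' : s ∈ Ioc 0 r := ⟨hs.1, hs.2.le.trans hu.2⟩
      have := hw0 s
      calc |b s| ≤ w s * (L * (S * q s) + c * q s) :=
            (hbw s hs').trans (by gcongr; exacts [hS s hs', hpow_le s hs.1])
        _ = (L * S + c) * w s * q s := by ring
  have hSle : S ≤ c / L := by
    have himp : S ≤ (L * S + c) / (2 * L) := csSup_le ⟨_, mem_image_of_mem _ hmem⟩
      (forall_mem_image.2 fun u hu => (div_le_iff₀ (hq0 u hu.1)).2 (himprove u hu))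
    rw [le_div_iff₀ (by positivity)] at himp ⊢
    linarith
  calc |f r| ≤ S * q r := hS r hmem
    _ ≤ c / L * (r ^ a * Real.exp (2 * L * Λ)) := by
      simp only [hq]
      gcongr
    _ = _ := by ring

end WeightedGronwall

section StaticProfile

lemma pow_even_nonneg (m : ℕ) (r : ℝ) : 0 ≤ r ^ (2 * (m + 1)) := by
  rw [pow_mul]; positivity

lemma one_add_pow_pos (m : ℕ) (r : ℝ) : 0 < 1 + r ^ (2 * (m + 1)) := by
  have := pow_even_nonneg m r
  linarith

lemma Q_contDiff (m : ℕ) : ContDiff ℝ ∞ (Q m) := by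
  unfold Q
  refine ContDiff.div (by fun_prop) (by fun_prop) fun r => (one_add_pow_pos m r).ne'

lemma Q_continuous (m : ℕ) : Continuous (Q m) := (Q_contDiff m).continuous

lemma Q_pos (m : ℕ) {r : ℝ} (hr : 0 < r) : 0 < Q m r := by
  unfold Q; positivity

lemma Q_nonneg (m : ℕ) {r : ℝ} (hr : 0 ≤ r) : 0 ≤ Q m r := by
  unfold Q
  positivity

lemma Q_sq (m : ℕ) (r : ℝ) :
    Q m r ^ 2 = 8 * ((m : ℝ) + 1) ^ 2 * r ^ (2 * m) / (1 + r ^ (2 * (m + 1))) ^ 2 := by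
  rw [Q, div_pow, mul_pow, mul_pow, Real.sq_sqrt (by norm_num), ← pow_mul, mul_comm m 2]

lemma pow_mul_Q_sq_le_const (m : ℕ) {r : ℝ} (hr : 0 ≤ r) :
    r ^ (2 * m + 4) * Q m r ^ 2 ≤ 8 * ((m : ℝ) + 1) ^ 2 := by
  have := pow_even_nonneg m r
  rw [Q_sq, mul_div_assoc', div_le_iff₀ (pow_pos (one_add_pow_pos m r) 2)]
  calc r ^ (2 * m + 4) * (8 * ((m : ℝ) + 1) ^ 2 * r ^ (2 * m))
      = 8 * ((m : ℝ) + 1) ^ 2 * (r ^ (2 * (m + 1))) ^ 2 := by ring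
    _ ≤ _ := by gcongr; linarith

lemma pow_mul_Q_sq_le (m p j : ℕ) (hp : p + j ≤ 2 * m + 4) {r : ℝ} (hr : 1 ≤ r) :
    r ^ p * Q m r ^ 2 ≤ 8 * ((m : ℝ) + 1) ^ 2 * (r ^ j)⁻¹ := by
  have hr0 : 0 < r := by linarith
  rw [← div_eq_mul_inv, le_div_iff₀ (by positivity)]
  refine le_trans ?_ (pow_mul_Q_sq_le_const m hr0.le)
  rw [mul_right_comm, ← pow_add]
  gcongr

lemma Q_sq_le (m : ℕ) {r : ℝ} (hr : 0 ≤ r) : Q m r ^ 2 ≤ 8 * ((m : ℝ) + 1) ^ 2 := by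
  rcases le_total r 1 with hr1 | hr1
  · have hp := pow_even_nonneg m r
    rw [Q_sq]
    refine div_le_of_le_mul₀ (by positivity) (by positivity) ?_
    gcongr
    exact (pow_le_one₀ hr hr1).trans (one_le_pow₀ (by linarith))
  · simpa using pow_mul_Q_sq_le m 0 0 (by omega) hr1

lemma sq_mul_Q_sq_le (m : ℕ) {r : ℝ} (hr : 0 ≤ r) :
    r ^ 2 * Q m r ^ 2 ≤ 8 * ((m : ℝ) + 1) ^ 2 := by
  rcases le_total r 1 with hr1 | hr1
  · exact (mul_le_of_le_one_left (sq_nonneg _) (pow_le_one₀ hr hr1)).trans (Q_sq_le m hr)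
  · simpa using pow_mul_Q_sq_le m 2 0 (by omega) hr1

lemma integrableOn_inv_pow {a : ℝ} (ha : 0 < a) {j : ℕ} (hj : 2 ≤ j) :
    IntegrableOn (fun r : ℝ => (r ^ j)⁻¹) (Ioi a) := by
  have hj' : -(j : ℝ) < -1 := neg_lt_neg (by exact_mod_cast hj)
  refine (integrableOn_Ioi_rpow_of_lt hj' ha).congr_fun (fun r hr => ?_) measurableSet_Ioi
  simp [Real.rpow_neg (ha.trans hr).le]

lemma integrableOn_pow_mul_Q_sq (m : ℕ) {p : ℕ} (hp : p ≤ 2 * m + 2) :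
    IntegrableOn (fun r => r ^ p * Q m r ^ 2) (Ioi (0 : ℝ)) := by
  have hc : Continuous (fun r => r ^ p * Q m r ^ 2) :=
    (continuous_pow p).mul ((Q_continuous m).pow 2)
  rw [← Ioc_union_Ioi_eq_Ioi (zero_le_one : (0 : ℝ) ≤ 1)]
  refine hc.integrableOn_Ioc.union (Integrable.mono'
    ((integrableOn_inv_pow one_pos le_rfl).const_mul (8 * ((m : ℝ) + 1) ^ 2))
    hc.aestronglyMeasurable.restrict ((ae_restrict_mem measurableSet_Ioi).mono fun r hr => ?_))
  have hr1 : (1 : ℝ) ≤ r := le_of_lt hr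
  rw [Real.norm_of_nonneg (by positivity)]
  exact pow_mul_Q_sq_le m p 2 (by omega) hr1

/-- The mass `∫_0^r s Q(s)² ds` of `Q` in the disc of radius `r`, in closed form. -/
def massQ (m : ℕ) (r : ℝ) : ℝ :=
  4 * ((m : ℝ) + 1) * r ^ (2 * (m + 1)) / (1 + r ^ (2 * (m + 1)))

lemma hasDerivAt_massQ (m : ℕ) (r : ℝ) : HasDerivAt (massQ m) (r * Q m r ^ 2) r := by
  have hpow : HasDerivAt (fun r : ℝ => r ^ (2 * (m + 1)))
      (2 * ((m : ℝ) + 1) * r ^ (2 * m + 1)) r := by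
    refine (hasDerivAt_pow (2 * (m + 1)) r).congr_deriv ?_
    rw [show 2 * (m + 1) - 1 = 2 * m + 1 by omega]
    push_cast
    ring
  have hp := (one_add_pow_pos m r).ne'
  refine ((hpow.const_mul (4 * ((m : ℝ) + 1))).div (hpow.const_add 1) hp).congr_deriv ?_
  rw [Q_sq]
  field_simp
  ring

lemma massQ_zero (m : ℕ) : massQ m 0 = 0 := by
  simp [massQ]

lemma massQ_nonneg (m : ℕ) (r : ℝ) : 0 ≤ massQ m r := by
  have := pow_even_nonneg m r
  unfold massQ
  positivity

lemma massQ_eq (m : ℕ) (r : ℝ) :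
    massQ m r = 4 * ((m : ℝ) + 1) - 4 * ((m : ℝ) + 1) / (1 + r ^ (2 * (m + 1))) := by
  have := (one_add_pow_pos m r).ne'
  unfold massQ
  field_simp
  ring

lemma massQ_le (m : ℕ) (r : ℝ) : massQ m r ≤ 4 * ((m : ℝ) + 1) := by
  have := one_add_pow_pos m r
  rw [massQ_eq]
  exact sub_le_self _ (by positivity)

lemma tendsto_massQ (m : ℕ) : Tendsto (massQ m) atTop (𝓝 (4 * ((m : ℝ) + 1))) := by
  have hden : Tendsto (fun r : ℝ => 1 + r ^ (2 * (m + 1))) atTop atTop :=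
    tendsto_atTop_add_const_left _ _ (tendsto_pow_atTop (by omega))
  rw [funext (massQ_eq m)]
  simpa only [sub_zero] using (tendsto_const_nhds (x := 4 * ((m : ℝ) + 1))).sub
    ((tendsto_const_nhds (x := 4 * ((m : ℝ) + 1))).div_atTop hden)

lemma integral_mul_Q_sq (m : ℕ) (r : ℝ) : ∫ s in (0 : ℝ)..r, s * Q m s ^ 2 = massQ m r := by
  rw [intervalIntegral.integral_eq_sub_of_hasDerivAt (fun s _ => hasDerivAt_massQ m s),
    massQ_zero, sub_zero]
  exact (continuous_id.mul ((Q_continuous m).pow 2)).intervalIntegrable _ _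

lemma integral_Ioi_mul_Q_sq (m : ℕ) {r : ℝ} (hr : 0 ≤ r) :
    ∫ s in Ioi r, s * Q m s ^ 2 = 4 * ((m : ℝ) + 1) - massQ m r := by
  refine integral_Ioi_of_hasDerivAt_of_tendsto' (fun s _ => hasDerivAt_massQ m s) ?_
    (tendsto_massQ m)
  simpa using (integrableOn_pow_mul_Q_sq m (p := 1) (by omega)).mono_set (Ioi_subset_Ioi hr)

lemma Atheta_Q (m : ℕ) (r : ℝ) : Atheta (Q m) r = -(massQ m r / 2) := by
  simp only [Atheta, sq_abs, mul_comm _ (_ : ℝ), ← integral_mul_Q_sq]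
  ring

lemma hasDerivAt_Q (m : ℕ) {r : ℝ} (hr : 0 < r) :
    HasDerivAt (Q m) (((m : ℝ) - massQ m r / 2) / r * Q m r) r := by
  have hpow : ∀ n : ℕ, HasDerivAt (fun r : ℝ => r ^ n) (n * r ^ n / r) r := fun n => by
    refine (hasDerivAt_pow n r).congr_deriv ?_
    rcases n with _ | n
    · simp
    · rw [Nat.add_sub_cancel, pow_succ]
      field_simp
  have hp := (one_add_pow_pos m r).ne'
  refine (((hpow m).const_mul (√8 * ((m : ℝ) + 1))).div
    ((hpow (2 * (m + 1))).const_add 1) hp).congr_deriv ?_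
  unfold massQ Q
  push_cast
  field_simp
  ring

/-- The second moment `∫_0^∞ r³ u² dr`, which is `(2π)⁻¹` times the plane integral of `|ru|²`. -/
def secondMoment (u : ℝ → ℝ) : ℝ := ∫ r in Ioi (0 : ℝ), r ^ 3 * u r ^ 2

lemma secondMoment_nonneg (u : ℝ → ℝ) : 0 ≤ secondMoment u :=
  setIntegral_nonneg measurableSet_Ioi fun _ hr =>
    mul_nonneg (pow_nonneg (le_of_lt hr) 3) (sq_nonneg _)

lemma abs_integral_le_mul_secondMoment {m : ℕ} (hm : 1 ≤ m) {b : ℝ → ℝ} {D r : ℝ} (hr : 0 ≤ r)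
    (hb : ∀ s, 0 < s → |b s| ≤ Q m s ^ 2 * (D * s ^ 2)) :
    |∫ s in (0 : ℝ)..r, s * b s| ≤ D * secondMoment (Q m) := by
  have hint : IntegrableOn (fun s => D * (s ^ 3 * Q m s ^ 2)) (Ioi 0) :=
    (integrableOn_pow_mul_Q_sq m (by omega)).const_mul D
  have hle : ∀ s, 0 < s → |s * b s| ≤ D * (s ^ 3 * Q m s ^ 2) := fun s hs => by
    rw [abs_mul, abs_of_pos hs]
    calc s * |b s| ≤ s * (Q m s ^ 2 * (D * s ^ 2)) := mul_le_mul_of_nonneg_left (hb s hs) hs.le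
      _ = _ := by ring
  rw [secondMoment, ← integral_const_mul]
  calc |∫ s in (0 : ℝ)..r, s * b s| ≤ ∫ s in Ioc 0 r, D * (s ^ 3 * Q m s ^ 2) := by
        rw [intervalIntegral.integral_of_le hr, ← Real.norm_eq_abs]
        exact norm_integral_le_of_norm_le (hint.mono_set Ioc_subset_Ioi_self)
          ((ae_restrict_mem measurableSet_Ioc).mono fun s hs => hle s hs.1)
    _ ≤ ∫ s in Ioi 0, D * (s ^ 3 * Q m s ^ 2) :=
      setIntegral_mono_set hint ((ae_restrict_mem measurableSet_Ioi).mono fun s hs =>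
        (abs_nonneg _).trans (hle s hs)) Ioc_subset_Ioi_self.eventuallyLE

end StaticProfile

section ExponentEquation

lemma abs_exp_sub_exp_le {x y : ℝ} (hx : x ≤ 1) (hy : y ≤ 1) :
    |Real.exp x - Real.exp y| ≤ 3 * |x - y| := by
  refine (convex_Iic 1).norm_image_sub_le_of_norm_deriv_le
    (fun z _ => Real.differentiableAt_exp) (fun z hz => ?_) hy hx
  rw [Real.deriv_exp, Real.norm_eq_abs, Real.abs_exp]
  exact (Real.exp_le_exp.2 hz).trans Real.exp_one_lt_three.le

lemma abs_exp_sub_one_le {x : ℝ} (hx : x ≤ 1) : |Real.exp x - 1| ≤ 3 * |x| := by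
  simpa using abs_exp_sub_exp_le hx zero_le_one

lemma abs_exp_sub_one_sub_self_le {x : ℝ} (hx : x ≤ 1) : |Real.exp x - 1 - x| ≤ x ^ 2 := by
  rcases le_total (-1) x with hx' | hx'
  · exact Real.abs_exp_sub_one_sub_id_le (abs_le.2 ⟨hx', hx⟩)
  · have hexp : Real.exp x ≤ 1 := Real.exp_le_one_iff.2 (by linarith)
    rw [abs_of_nonneg (by linarith [Real.add_one_le_exp x])]
    nlinarith

lemma lipschitzWith_truncatedExp : LipschitzWith 3 fun x : ℝ => Real.exp (min x 1) - 1 := by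
  refine LipschitzWith.of_dist_le_mul fun x y => ?_
  rw [Real.dist_eq, Real.dist_eq, sub_sub_sub_cancel_right]
  refine (abs_exp_sub_exp_le (min_le_right _ _) (min_le_right _ _)).trans ?_
  have hmin : |min x 1 - min y 1| ≤ |x - y| := by
    simpa only [sub_self, abs_zero, sup_of_le_left (abs_nonneg (x - y))] using
      abs_min_sub_min_le_max x 1 y 1
  push_cast
  linarith

/-- `φ` solves `-Δφ = Q² F(φ - ηr²/2)` with `φ(0) = 0`. For `F(x) = eˣ - 1` this is the equation
of the exponent `φ` of a deformed profile; `F(x) = x` and `η = 1` give its first variation. -/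
abbrev IsExponent (m : ℕ) (F : ℝ → ℝ) (η : ℝ) (φ : ℝ → ℝ) : Prop :=
  IsRadialPotential (fun s => Q m s ^ 2 * F (φ s - η * s ^ 2 / 2)) φ

/-- `φ₁` is the derivative at `η = 0` of the exponents of the deformed profiles. -/
abbrev IsFirstVariation (m : ℕ) (φ₁ : ℝ → ℝ) : Prop :=
  IsRadialPotential (fun s => Q m s ^ 2 * (φ₁ s - s ^ 2 / 2)) φ₁

variable {m : ℕ} {F : ℝ → ℝ} {η : ℝ} {φ φ₁ : ℝ → ℝ}

lemma IsExponent.continuous_source (h : IsExponent m F η φ) (hF : Continuous F) :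
    Continuous fun s => Q m s ^ 2 * F (φ s - η * s ^ 2 / 2) := by
  have := h.continuous
  have := Q_continuous m
  fun_prop

lemma exists_isExponent (m : ℕ) {K : NNReal} (hF : LipschitzWith K F) (hF0 : F 0 = 0)
    (hη : 0 ≤ η) : ∃ φ, IsExponent m F η φ := by
  have hlip : ∀ x y, |F x - F y| ≤ K * |x - y| := hF.dist_le_mul
  have hFc := hF.continuous
  have hQc := Q_continuous m
  refine exists_isRadialPotential_semilinear (N := fun s x => Q m s ^ 2 * F (x - η * s ^ 2 / 2))
    (K := 8 * ((m : ℝ) + 1) ^ 2 * K) (A := K * η / 2 * (8 * ((m : ℝ) + 1) ^ 2))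
    (by unfold Function.uncurry; fun_prop) (fun s hs x y => ?_) fun s hs => ?_
  · rw [← mul_sub, abs_mul, abs_of_nonneg (sq_nonneg _), mul_assoc]
    have := hlip (x - η * s ^ 2 / 2) (y - η * s ^ 2 / 2)
    rw [sub_sub_sub_cancel_right] at this
    gcongr
    exact Q_sq_le m hs
  · have hsource : |F (0 - η * s ^ 2 / 2)| ≤ K * (η * s ^ 2 / 2) := by
      have hs2 : 0 ≤ η * s ^ 2 / 2 := by positivity
      calc |F (0 - η * s ^ 2 / 2)| = |F (0 - η * s ^ 2 / 2) - F 0| := by rw [hF0, sub_zero]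
        _ ≤ K * |0 - η * s ^ 2 / 2 - 0| := hlip _ _
        _ = _ := by rw [sub_zero, zero_sub, abs_neg, abs_of_nonneg hs2]
    rw [abs_mul, abs_of_nonneg (sq_nonneg _)]
    calc Q m s ^ 2 * |F (0 - η * s ^ 2 / 2)| ≤ Q m s ^ 2 * (K * (η * s ^ 2 / 2)) := by gcongr
      _ = K * η / 2 * (s ^ 2 * Q m s ^ 2) := by ring
      _ ≤ _ := mul_le_mul_of_nonneg_left (sq_mul_Q_sq_le m hs) (by positivity)

lemma abs_sub_mul_sq_div_two_le {x C s : ℝ} (hη : 0 ≤ η) (hx : |x| ≤ C * η * s ^ 2) :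
    |x - η * s ^ 2 / 2| ≤ (C + 1 / 2) * η * s ^ 2 := by
  refine (abs_sub _ _).trans ?_
  rw [abs_of_nonneg (by positivity : 0 ≤ η * s ^ 2 / 2)]
  linarith

lemma IsExponent.abs_le_mul_sq (h : IsExponent m F η φ) (hFc : Continuous F) {L : ℝ} (hL : 0 < L)
    (hF : ∀ x, |F x| ≤ L * |x|) (hη : 0 ≤ η) {r : ℝ} (hr : 0 ≤ r) :
    |φ r| ≤ Real.exp (8 * L * ((m : ℝ) + 1)) / 2 * η * r ^ 2 := by
  have hb := h.continuous_source hFc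
  obtain ⟨A, -, hA⟩ := h.exists_abs_le_mul_sq hb r
  refine (h.abs_le_of_abs_source_le (w := fun s => Q m s ^ 2) hb ((Q_continuous m).pow 2)
    (fun s => sq_nonneg _) (a := 2) (L := L) (c := L * η / 2) one_le_two hL (by positivity) hr
    ((integral_mul_Q_sq m r).trans_le (massQ_le m r)) (fun s _ => ?_)
    fun s hs => hA s ⟨hs.1.le, hs.2⟩).trans_eq ?_
  · rw [abs_mul, abs_of_nonneg (sq_nonneg _)]
    gcongr
    have habs : |φ s - η * s ^ 2 / 2| ≤ |φ s| + η * s ^ 2 / 2 :=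
      (abs_sub _ _).trans_eq (by rw [abs_of_nonneg (by positivity : 0 ≤ η * s ^ 2 / 2)])
    calc |F (φ s - η * s ^ 2 / 2)| ≤ L * |φ s - η * s ^ 2 / 2| := hF _
      _ ≤ L * (|φ s| + η * s ^ 2 / 2) := by gcongr
      _ = _ := by ring
  · field_simp
    ring_nf

lemma abs_le_one_add_of_abs_deriv_le {f f' : ℝ → ℝ} {C K r : ℝ} (hf : Continuous f) (hη : 0 ≤ η)
    (hC : 0 ≤ C) (hK : 0 ≤ K) (hsmall : 2 * C * K * η ≤ 1)
    (hd : ∀ u > 0, HasDerivAt f (f' u) u) (hf' : ∀ u > 0, |f' u| ≤ K * η / u)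
    (hfC : ∀ u, 0 ≤ u → |f u| ≤ C * η * u ^ 2) (hr : 0 ≤ r) : |f r| ≤ 1 + η * r ^ 2 / 4 := by
  have hnear : ∀ u, 0 ≤ u → u ^ 2 ≤ 2 * K → |f u| ≤ 1 + η * u ^ 2 / 4 := fun u hu huK =>
    calc |f u| ≤ C * η * u ^ 2 := hfC u hu
      _ ≤ C * η * (2 * K) := by gcongr
      _ ≤ 1 := by linarith
      _ ≤ _ := le_add_of_nonneg_right (by positivity)
  rcases le_total (r ^ 2) (2 * K) with hrK | hrK
  · exact hnear r hr hrK
  have hg : ∀ u : ℝ, HasDerivAt (fun u => 1 + η * u ^ 2 / 4) (η * u / 2) u := fun u => by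
    refine ((((hasDerivAt_pow 2 u).const_mul η).div_const 4).const_add 1).congr_deriv ?_
    push_cast
    ring
  have hpos : ∀ u ∈ Ioo √(2 * K) r, 0 < u := fun u hu => (Real.sqrt_nonneg _).trans_lt hu.1
  refine abs_le_of_abs_deriv_le (Real.sqrt_le_iff.2 ⟨hr, hrK⟩) hf.continuousOn
    (HasDerivAt.continuousOn fun u _ => hg u) (fun u hu => hd u (hpos u hu)) (fun u _ => hg u)
    (hnear _ (Real.sqrt_nonneg _) (Real.sq_sqrt (by positivity)).le)
    fun u hu => (hf' u (hpos u hu)).trans ?_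
  have huK : 2 * K ≤ u ^ 2 := (Real.sqrt_le_left (hpos u hu).le).1 hu.1.le
  rw [div_le_iff₀ (hpos u hu)]
  nlinarith

/-- The mass `∫_0^r s (|Q^η|² - Q²) ds` that the deformed profile with exponent `φ` has in excess of
`Q` in the disc of radius `r`. -/
def excessMass (m : ℕ) (η : ℝ) (φ : ℝ → ℝ) (r : ℝ) : ℝ :=
  ∫ s in (0 : ℝ)..r, s * (Q m s ^ 2 * (Real.exp (φ s - η * s ^ 2 / 2) - 1))

/-- `φ` is the exponent of a deformed profile, with the bounds that hold uniformly in small `η`;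
`C` collects the constants. -/
structure IsDeformationExponent (m : ℕ) (C η : ℝ) (φ : ℝ → ℝ) : Prop where
  isExponent : IsExponent m (fun x => Real.exp x - 1) η φ
  nonneg : 0 ≤ η
  const_ge : 4 * ((m : ℝ) + 1) ≤ C
  mul_le_one : C * η ≤ 1
  abs_le_mul_sq : ∀ r, 0 ≤ r → |φ r| ≤ C * η * r ^ 2
  abs_le_one_add : ∀ r, 0 ≤ r → |φ r| ≤ 1 + η * r ^ 2 / 4
  abs_excessMass_le : ∀ r, 0 ≤ r → |excessMass m η φ r| ≤ C * η

lemma IsExponent.abs_integral_le (hm : 1 ≤ m) {L C : ℝ} (hL : 0 ≤ L)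
    (hF : ∀ x, |F x| ≤ L * |x|) (hη : 0 ≤ η) (hφ : ∀ r, 0 ≤ r → |φ r| ≤ C * η * r ^ 2)
    {r : ℝ} (hr : 0 ≤ r) :
    |∫ s in (0 : ℝ)..r, s * (Q m s ^ 2 * F (φ s - η * s ^ 2 / 2))| ≤
      L * (C + 1 / 2) * secondMoment (Q m) * η := by
  refine (abs_integral_le_mul_secondMoment hm (D := L * (C + 1 / 2) * η) hr
    fun s hs => ?_).trans_eq (by ring)
  rw [abs_mul, abs_of_nonneg (sq_nonneg _)]
  gcongr
  calc |F (φ s - η * s ^ 2 / 2)| ≤ L * |φ s - η * s ^ 2 / 2| := hF _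
    _ ≤ L * ((C + 1 / 2) * η * s ^ 2) := by
      gcongr
      exact abs_sub_mul_sq_div_two_le hη (hφ s hs.le)
    _ = _ := by ring

lemma IsExponent.abs_le_one_add (h : IsExponent m F η φ) (hη : 0 ≤ η) {C K : ℝ} (hC : 0 ≤ C)
    (hK : 0 ≤ K) (hsmall : 2 * C * K * η ≤ 1) (hφ : ∀ r, 0 ≤ r → |φ r| ≤ C * η * r ^ 2)
    (hmass : ∀ r, 0 ≤ r →
      |∫ s in (0 : ℝ)..r, s * (Q m s ^ 2 * F (φ s - η * s ^ 2 / 2))| ≤ K * η)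
    {r : ℝ} (hr : 0 ≤ r) : |φ r| ≤ 1 + η * r ^ 2 / 4 := by
  refine abs_le_one_add_of_abs_deriv_le h.continuous hη hC hK hsmall h.hasDerivAt
    (fun u hu => ?_) hφ hr
  rw [abs_neg, radialMean, abs_mul, abs_inv, abs_of_pos hu, inv_mul_eq_div]
  gcongr
  exact hmass u hu.le

theorem exists_isDeformationExponent (hm : 1 ≤ m) : ∃ C η₀ : ℝ, 0 < η₀ ∧
    ∀ η, 0 ≤ η → η ≤ η₀ → ∃ φ, IsDeformationExponent m C η φ := by
  set C₁ : ℝ := Real.exp (8 * 3 * ((m : ℝ) + 1)) / 2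
  have hC₁ : 0 < C₁ := by positivity
  set K : ℝ := 3 * (C₁ + 1 / 2) * secondMoment (Q m)
  have hK : 0 ≤ K := mul_nonneg (by positivity) (secondMoment_nonneg (Q m))
  set C : ℝ := C₁ + K + 4 * ((m : ℝ) + 1) with hC
  have hC₁C : C₁ ≤ C := by rw [hC]; linarith [(m.cast_nonneg : (0 : ℝ) ≤ m)]
  have hKC : K ≤ C := by rw [hC]; linarith [(m.cast_nonneg : (0 : ℝ) ≤ m)]
  have hden : 0 < 2 * C₁ * K + C := by positivity
  refine ⟨C, 1 / (2 * C₁ * K + C), by positivity, fun η hη hη₀ => ?_⟩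
  rw [le_div_iff₀ hden] at hη₀
  obtain ⟨φ, hφ⟩ := exists_isExponent m lipschitzWith_truncatedExp (by simp) hη
  have hF : ∀ x : ℝ, |Real.exp (min x 1) - 1| ≤ 3 * |x| := fun x => by
    simpa [Real.dist_eq] using lipschitzWith_truncatedExp.dist_le_mul x 0
  have hquad : ∀ r, 0 ≤ r → |φ r| ≤ C₁ * η * r ^ 2 := fun r hr =>
    hφ.abs_le_mul_sq lipschitzWith_truncatedExp.continuous (by norm_num) hF hη hr
  have hmass : ∀ r : ℝ, 0 ≤ r → |∫ s in (0 : ℝ)..r, s * (Q m s ^ 2 *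
      (Real.exp (min (φ s - η * s ^ 2 / 2) 1) - 1))| ≤ K * η := fun r hr =>
    IsExponent.abs_integral_le hm (by norm_num) hF hη hquad hr
  have hbound : ∀ r, 0 ≤ r → |φ r| ≤ 1 + η * r ^ 2 / 4 := fun r hr =>
    hφ.abs_le_one_add hη hC₁.le hK (by nlinarith) hquad hmass hr
  have htrunc : ∀ s, 0 ≤ s → min (φ s - η * s ^ 2 / 2) 1 = φ s - η * s ^ 2 / 2 := fun s hs => by
    have : 0 ≤ η * s ^ 2 := by positivity
    exact min_eq_left (by linarith [le_of_abs_le (hbound s hs)])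
  refine ⟨φ, hφ.congr_source fun s hs => by simp only [htrunc s hs], hη, by linarith [hC],
    by nlinarith, fun r hr => (hquad r hr).trans (by gcongr), hbound, fun r hr => ?_⟩
  have hexcess : excessMass m η φ r = ∫ s in (0 : ℝ)..r, s * (Q m s ^ 2 *
      (Real.exp (min (φ s - η * s ^ 2 / 2) 1) - 1)) := by
    refine intervalIntegral.integral_congr fun s hs => ?_
    simp only [htrunc s (uIcc_of_le hr ▸ hs).1]
  rw [hexcess]
  exact (hmass r hr).trans (by gcongr)

theorem exists_isFirstVariation (m : ℕ) : ∃ φ₁ C, IsFirstVariation m φ₁ ∧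
    ∀ r, 0 ≤ r → |φ₁ r| ≤ C * r ^ 2 := by
  obtain ⟨φ₁, h⟩ := exists_isExponent m LipschitzWith.id rfl zero_le_one
  have hbound := fun r hr =>
    h.abs_le_mul_sq continuous_id one_pos (by simp) zero_le_one (r := r) hr
  simp only [mul_one] at hbound
  exact ⟨φ₁, _, h.congr_source fun s _ => by rw [id, one_mul], hbound⟩

namespace IsDeformationExponent

variable {C : ℝ}

lemma const_pos (h : IsDeformationExponent m C η φ) : 0 < C :=
  lt_of_lt_of_le (by positivity) h.const_ge

lemma sub_le_one (h : IsDeformationExponent m C η φ) {s : ℝ} (hs : 0 ≤ s) :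
    φ s - η * s ^ 2 / 2 ≤ 1 := by
  have : 0 ≤ η * s ^ 2 := mul_nonneg h.nonneg (sq_nonneg s)
  linarith [le_of_abs_le (h.abs_le_one_add s hs)]

lemma abs_exp_sub_one_sub_le (h : IsDeformationExponent m C η φ) {s : ℝ} (hs : 0 ≤ s) :
    |Real.exp (φ s - η * s ^ 2 / 2) - 1 - η * (φ₁ s - s ^ 2 / 2)| ≤
      |φ s - η * φ₁ s| + (C + 1 / 2) ^ 2 * η ^ 2 * s ^ 4 := by
  set x := φ s - η * s ^ 2 / 2 with hx
  have hsq : x ^ 2 ≤ (C + 1 / 2) ^ 2 * η ^ 2 * s ^ 4 := by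
    have hle := abs_sub_mul_sq_div_two_le h.nonneg (h.abs_le_mul_sq s hs)
    calc x ^ 2 = |x| ^ 2 := (sq_abs x).symm
      _ ≤ ((C + 1 / 2) * η * s ^ 2) ^ 2 := by gcongr
      _ = _ := by ring
  calc |Real.exp x - 1 - η * (φ₁ s - s ^ 2 / 2)|
      = |(φ s - η * φ₁ s) + (Real.exp x - 1 - x)| := by rw [hx]; ring_nf
    _ ≤ |φ s - η * φ₁ s| + |Real.exp x - 1 - x| := abs_add_le _ _
    _ ≤ _ := by gcongr; exact (abs_exp_sub_one_sub_self_le (h.sub_le_one hs)).trans hsq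

theorem abs_sub_firstVariation_le (h : IsDeformationExponent m C η φ) (h₁ : IsFirstVariation m φ₁)
    {r : ℝ} (hr : 0 ≤ r) :
    |φ r - η * φ₁ r| ≤ (C + 1 / 2) ^ 2 * Real.exp (8 * ((m : ℝ) + 1)) * (η ^ 2 * r ^ 4) := by
  have hb := IsExponent.continuous_source h.isExponent (by fun_prop)
  have hb₁ : Continuous fun s => Q m s ^ 2 * (φ₁ s - s ^ 2 / 2) := by
    have := h₁.continuous
    have := Q_continuous m
    fun_prop
  have hψ := h.isExponent.sub_const_mul h₁ hb hb₁ η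
  have hbψ := hb.sub (hb₁.const_mul η)
  set c := (C + 1 / 2) ^ 2 * η ^ 2
  have hsource : ∀ s, 0 ≤ s → |Q m s ^ 2 * (Real.exp (φ s - η * s ^ 2 / 2) - 1) -
      η * (Q m s ^ 2 * (φ₁ s - s ^ 2 / 2))| ≤ Q m s ^ 2 * (1 * |φ s - η * φ₁ s| + c * s ^ 4) :=
    fun s hs => by
      rw [mul_left_comm η, ← mul_sub, abs_mul, abs_of_nonneg (sq_nonneg _), one_mul]
      exact mul_le_mul_of_nonneg_left (h.abs_exp_sub_one_sub_le hs) (sq_nonneg _)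
  obtain ⟨A, _, hA⟩ := hψ.exists_abs_le_mul_sq hbψ r
  have hquartic : ∀ s ∈ Ioc 0 r, |φ s - η * φ₁ s| ≤ _ * s ^ (2 + 2) := fun s hs =>
    hψ.abs_le_mul_pow hbψ (D := 8 * ((m : ℝ) + 1) ^ 2 * (A + c * r ^ 2)) hs.1.le fun u hu => by
      have hur : u ≤ r := hu.2.le.trans hs.2
      have hu2 : u ^ 2 ≤ r ^ 2 := pow_le_pow_left₀ hu.1.le hur 2
      calc _ ≤ Q m u ^ 2 * (1 * |φ u - η * φ₁ u| + c * u ^ 4) := hsource u hu.1.le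
        _ ≤ 8 * ((m : ℝ) + 1) ^ 2 * (1 * (A * u ^ 2) + c * (r ^ 2 * u ^ 2)) := by
          rw [show u ^ 4 = u ^ 2 * u ^ 2 by ring]
          gcongr
          exacts [Q_sq_le m hu.1.le, hA u ⟨hu.1.le, hur⟩]
        _ = _ := by ring
  refine (hψ.abs_le_of_abs_source_le (w := fun s => Q m s ^ 2) hbψ ((Q_continuous m).pow 2)
    (fun s => sq_nonneg _) (by norm_num) one_pos (by positivity) hr
    ((integral_mul_Q_sq m r).trans_le (massQ_le m r)) (fun s hs => hsource s hs.1.le)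
    hquartic).trans_eq ?_
  rw [div_one, mul_one, ← mul_assoc 2 4, show (2 : ℝ) * 4 = 8 by norm_num]
  ring

end IsDeformationExponent

end ExponentEquation

section GeneralizedMode

/-- The generalized eigenmode `ρ` of `L_Q`, in terms of the first variation `φ₁` of the exponent. -/
def mode (m : ℕ) (φ₁ : ℝ → ℝ) (r : ℝ) : ℝ :=
  -(Q m r * (φ₁ r - r ^ 2 / 2)) / (2 * ((m : ℝ) + 1))

variable {m : ℕ} {φ₁ : ℝ → ℝ} {C r : ℝ}

lemma Lop_mode (h : IsFirstVariation m φ₁) (hr : 0 < r) :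
    Lop m (Q m) (mode m φ₁) r = 1 / (2 * ((m : ℝ) + 1)) * (r * Q m r) := by
  have hsq : HasDerivAt (fun r : ℝ => r ^ 2 / 2) r r := by
    simpa using (hasDerivAt_pow 2 r).div_const 2
  have hmode : HasDerivAt (mode m φ₁) _ r :=
    (((hasDerivAt_Q m hr).mul ((h.hasDerivAt r hr).sub hsq)).neg).div_const (2 * ((m : ℝ) + 1))
  have hB : ∫ s in (0 : ℝ)..r, Q m s * mode m φ₁ s * s = -(1 / (2 * ((m : ℝ) + 1))) *
      ∫ s in (0 : ℝ)..r, s * (Q m s ^ 2 * (φ₁ s - s ^ 2 / 2)) := by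
    rw [← intervalIntegral.integral_const_mul]
    refine intervalIntegral.integral_congr fun s _ => ?_
    simp only [mode]
    ring
  rw [Lop, Dplus, Bop, hmode.deriv, hB, Atheta_Q]
  simp only [mode, radialMean, Pi.sub_apply]
  field_simp
  ring

lemma LopAdj_Lop_mode (h : IsFirstVariation m φ₁) (hr : 0 < r) :
    LopAdj m (Q m) (Lop m (Q m) (mode m φ₁)) r = Q m r := by
  have hderiv : HasDerivAt (fun r => 1 / (2 * ((m : ℝ) + 1)) * (r * Q m r))
      (1 / (2 * ((m : ℝ) + 1)) * (1 * Q m r + r * (((m : ℝ) - massQ m r / 2) / r * Q m r))) r :=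
    ((hasDerivAt_id r).mul (hasDerivAt_Q m hr)).const_mul _
  have hLop : Lop m (Q m) (mode m φ₁) =ᶠ[𝓝 r] fun r => 1 / (2 * ((m : ℝ) + 1)) * (r * Q m r) :=
    by filter_upwards [Ioi_mem_nhds hr] with s hs using Lop_mode h hs
  have htail : ∫ s in Ioi r, Q m s * Lop m (Q m) (mode m φ₁) s =
      1 / (2 * ((m : ℝ) + 1)) * (4 * ((m : ℝ) + 1) - massQ m r) := by
    rw [← integral_Ioi_mul_Q_sq m hr.le, ← integral_const_mul]
    refine setIntegral_congr_fun measurableSet_Ioi fun s hs => ?_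
    simp only [Lop_mode h (hr.trans hs)]
    ring
  rw [LopAdj, DplusAdj, BopAdj, hLop.deriv_eq, hderiv.deriv, htail, Lop_mode h hr, Atheta_Q]
  field_simp
  ring

theorem isGeneralizedMode_mode (h : IsFirstVariation m φ₁)
    (hφ₁ : ∀ r, 0 ≤ r → |φ₁ r| ≤ C * r ^ 2) : IsGeneralizedMode m (mode m φ₁) where
  smooth := by
    have hQ := Q_contDiff m
    have hN : ContDiff ℝ ∞ (Function.uncurry fun s x => Q m s ^ 2 * (x - s ^ 2 / 2)) := by
      unfold Function.uncurry
      fun_prop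
    have hφ := h.contDiffOn_of_semilinear (N := fun s x => Q m s ^ 2 * (x - s ^ 2 / 2)) hN
    exact (hQ.contDiffOn.mul (hφ.sub (by fun_prop))).neg.div_const _
  eqn _ := LopAdj_Lop_mode h
  first_order _ := Lop_mode h
  bound := by
    refine ⟨(C + 1 / 2) / (2 * ((m : ℝ) + 1)), fun r hr => ?_⟩
    have hQ := Q_pos m hr
    have hφ : |φ₁ r - r ^ 2 / 2| ≤ (C + 1 / 2) * r ^ 2 := by
      simpa using abs_sub_mul_sq_div_two_le zero_le_one (by simpa using hφ₁ r hr.le)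
    rw [mode, abs_div, abs_neg, abs_mul, abs_of_pos hQ,
      abs_of_pos (by positivity : 0 < 2 * ((m : ℝ) + 1)), div_mul_eq_mul_div]
    refine div_le_div_of_nonneg_right ?_ (by positivity)
    calc Q m r * |φ₁ r - r ^ 2 / 2| ≤ Q m r * ((C + 1 / 2) * r ^ 2) := by gcongr
      _ = _ := by ring

end GeneralizedMode

section DeformedProfile

/-- The profile `P^η = Q e^{φ/2}` with exponent `φ`. -/
def deformedP (m : ℕ) (φ : ℝ → ℝ) (r : ℝ) : ℝ := Q m r * Real.exp (φ r / 2)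

/-- The profile `Q^η = e^{-ηr²/4} P^η` with exponent `φ`. -/
def deformedQ (m : ℕ) (η : ℝ) (φ : ℝ → ℝ) (r : ℝ) : ℝ :=
  Real.exp (-(η * r ^ 2 / 4)) * deformedP m φ r

/-- The total angular momentum density `m + A_θ[u]`. For `u = Q^η` it is the logarithmic derivative
`r ∂_r P^η / P^η`. -/
def angular (m : ℕ) (u : ℝ → ℝ) (r : ℝ) : ℝ := (m : ℝ) + Atheta u r

variable {m : ℕ} {C η : ℝ} {φ φ₁ : ℝ → ℝ} {r : ℝ}

lemma deformedQ_eq (m : ℕ) (η : ℝ) (φ : ℝ → ℝ) (r : ℝ) :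
    deformedQ m η φ r = Q m r * Real.exp ((φ r - η * r ^ 2 / 2) / 2) := by
  rw [deformedQ, deformedP, mul_left_comm, ← Real.exp_add]
  ring_nf

lemma deformedQ_sq (m : ℕ) (η : ℝ) (φ : ℝ → ℝ) (r : ℝ) :
    deformedQ m η φ r ^ 2 = Q m r ^ 2 * Real.exp (φ r - η * r ^ 2 / 2) := by
  rw [deformedQ_eq, mul_pow, ← Real.exp_nat_mul]
  congr 2
  push_cast
  ring

lemma deformedQ_sub_eq (m : ℕ) (η : ℝ) (φ : ℝ → ℝ) (r : ℝ) :
    deformedQ m η φ r - Q m r = Q m r * (Real.exp ((φ r - η * r ^ 2 / 2) / 2) - 1) := by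
  rw [deformedQ_eq]
  ring

lemma deformedP_pos (m : ℕ) (φ : ℝ → ℝ) (hr : 0 < r) : 0 < deformedP m φ r :=
  mul_pos (Q_pos m hr) (Real.exp_pos _)

lemma deformedQ_pos (m : ℕ) (η : ℝ) (φ : ℝ → ℝ) (hr : 0 < r) : 0 < deformedQ m η φ r :=
  mul_pos (Real.exp_pos _) (deformedP_pos m φ hr)

lemma deformedQ_nonneg (m : ℕ) (η : ℝ) (φ : ℝ → ℝ) (hr : 0 ≤ r) : 0 ≤ deformedQ m η φ r :=
  mul_nonneg (Real.exp_pos _).le (mul_nonneg (Q_nonneg m hr) (Real.exp_pos _).le)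

lemma continuous_deformedQ (hφ : Continuous φ) : Continuous (deformedQ m η φ) := by
  have := Q_continuous m
  unfold deformedQ deformedP
  fun_prop

lemma angular_deformedQ (hφ : Continuous φ) (r : ℝ) :
    angular m (deformedQ m η φ) r = (m : ℝ) - massQ m r / 2 - excessMass m η φ r / 2 := by
  have hQ := Q_continuous m
  have hmass : ∫ s in (0 : ℝ)..r, |deformedQ m η φ s| ^ 2 * s = massQ m r + excessMass m η φ r := by
    rw [← integral_mul_Q_sq, excessMass, ← intervalIntegral.integral_add]
    · refine intervalIntegral.integral_congr fun s _ => ?_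
      simp only [sq_abs, deformedQ_sq]
      ring
    all_goals exact Continuous.intervalIntegrable (by fun_prop) _ _
  rw [angular, Atheta, hmass]
  ring

namespace IsDeformationExponent

lemma continuous (h : IsDeformationExponent m C η φ) : Continuous φ := h.isExponent.continuous

lemma contDiffOn (h : IsDeformationExponent m C η φ) : ContDiffOn ℝ ∞ φ (Ioi 0) := by
  have hQ := Q_contDiff m
  refine h.isExponent.contDiffOn_of_semilinear
    (N := fun s x => Q m s ^ 2 * (Real.exp (x - η * s ^ 2 / 2) - 1)) ?_
  unfold Function.uncurry
  fun_prop

lemma contDiffOn_deformedP (h : IsDeformationExponent m C η φ) :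
    ContDiffOn ℝ ∞ (deformedP m φ) (Ioi 0) :=
  (Q_contDiff m).contDiffOn.mul (Real.contDiff_exp.comp_contDiffOn (h.contDiffOn.div_const 2))

lemma contDiffOn_deformedQ (h : IsDeformationExponent m C η φ) :
    ContDiffOn ℝ ∞ (deformedQ m η φ) (Ioi 0) :=
  ContDiffOn.mul (by fun_prop) h.contDiffOn_deformedP

lemma hasDerivAt_deformedP (h : IsDeformationExponent m C η φ) (hr : 0 < r) :
    HasDerivAt (deformedP m φ) (angular m (deformedQ m η φ) r / r * deformedP m φ r) r := by
  have hφ : HasDerivAt φ (-(r⁻¹ * excessMass m η φ r)) r := h.isExponent.hasDerivAt r hr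
  refine ((hasDerivAt_Q m hr).mul (hφ.div_const 2).exp).congr_deriv ?_
  rw [angular_deformedQ h.continuous, deformedP]
  field_simp
  ring

lemma hasDerivAt_deformedQ (h : IsDeformationExponent m C η φ) (hr : 0 < r) :
    HasDerivAt (deformedQ m η φ)
      ((angular m (deformedQ m η φ) r / r - η * r / 2) * deformedQ m η φ r) r := by
  have hgauss : HasDerivAt (fun r : ℝ => -(η * r ^ 2 / 4)) (-(η * r / 2)) r := by
    refine (((hasDerivAt_pow 2 r).const_mul η).div_const 4).neg.congr_deriv ?_
    push_cast
    ring
  refine (hgauss.exp.mul (h.hasDerivAt_deformedP hr)).congr_deriv ?_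
  rw [deformedQ]
  ring

lemma Dplus_deformedP (h : IsDeformationExponent m C η φ) (hr : 0 < r) :
    Dplus m (deformedQ m η φ) (deformedP m φ) r = 0 := by
  rw [Dplus, (h.hasDerivAt_deformedP hr).deriv, angular, sub_self]

lemma angular_le (h : IsDeformationExponent m C η φ) (hm : 1 ≤ m) (hr : 0 ≤ r)
    (hfar : 2 * ((m : ℝ) + 1) ≤ r ^ (2 * (m + 1))) :
    angular m (deformedQ m η φ) r ≤ -3 / 2 := by
  have hm' : (1 : ℝ) ≤ m := by exact_mod_cast hm
  have hexcess := neg_le_of_abs_le ((h.abs_excessMass_le r hr).trans h.mul_le_one)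
  have hmass : 4 * ((m : ℝ) + 1) / (1 + r ^ (2 * (m + 1))) ≤ 2 := by
    rw [div_le_iff₀ (one_add_pow_pos m r)]
    linarith
  rw [angular_deformedQ h.continuous, massQ_eq]
  linarith

lemma abs_angular_le (h : IsDeformationExponent m C η φ) (hr : 0 ≤ r) :
    |angular m (deformedQ m η φ) r| ≤ 3 * ((m : ℝ) + 1) := by
  have : (0 : ℝ) ≤ m := m.cast_nonneg
  have hexcess := abs_le.1 ((h.abs_excessMass_le r hr).trans h.mul_le_one)
  have hnonneg := massQ_nonneg m r
  have hle := massQ_le m r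
  rw [angular_deformedQ h.continuous, abs_le]
  constructor <;> linarith [hexcess.1, hexcess.2]

lemma abs_sub_div_two_le (h : IsDeformationExponent m C η φ) (hr : 0 ≤ r) :
    |(φ r - η * r ^ 2 / 2) / 2| ≤ (C + 1) * η * r ^ 2 := by
  have hle := abs_sub_mul_sq_div_two_le h.nonneg (h.abs_le_mul_sq r hr)
  have : 0 ≤ η * r ^ 2 := mul_nonneg h.nonneg (sq_nonneg r)
  have : 0 ≤ C * (η * r ^ 2) := mul_nonneg h.const_pos.le this
  rw [abs_div, abs_two]
  linarith

lemma sub_div_two_le_one (h : IsDeformationExponent m C η φ) (hr : 0 ≤ r) :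
    (φ r - η * r ^ 2 / 2) / 2 ≤ 1 := by
  linarith [h.sub_le_one hr]

lemma deformedQ_le_exp_mul (h : IsDeformationExponent m C η φ) (hr : 0 ≤ r) :
    deformedQ m η φ r ≤ 3 * Real.exp (-(η * r ^ 2 / 8)) * Q m r := by
  have hexp : (φ r - η * r ^ 2 / 2) / 2 ≤ 1 + -(η * r ^ 2 / 8) := by
    linarith [le_of_abs_le (h.abs_le_one_add r hr)]
  have := Q_nonneg m hr
  calc deformedQ m η φ r ≤ Q m r * Real.exp (1 + -(η * r ^ 2 / 8)) := by
        rw [deformedQ_eq]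
        gcongr
    _ = Real.exp 1 * Real.exp (-(η * r ^ 2 / 8)) * Q m r := by rw [Real.exp_add]; ring
    _ ≤ _ := by gcongr; exact Real.exp_one_lt_three.le

lemma deformedQ_le (h : IsDeformationExponent m C η φ) (hr : 0 ≤ r) :
    deformedQ m η φ r ≤ 3 * Q m r := by
  have := Q_nonneg m hr
  have hgauss : Real.exp (-(η * r ^ 2 / 8)) ≤ 1 :=
    Real.exp_le_one_iff.2 (by linarith [mul_nonneg h.nonneg (sq_nonneg r)])
  calc _ ≤ 3 * Real.exp (-(η * r ^ 2 / 8)) * Q m r := h.deformedQ_le_exp_mul hr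
    _ ≤ 3 * 1 * Q m r := by gcongr
    _ = _ := by ring

lemma deformedQ_sq_le (h : IsDeformationExponent m C η φ) (hr : 0 ≤ r) :
    deformedQ m η φ r ^ 2 ≤ 9 * Q m r ^ 2 := by
  have := deformedQ_nonneg m η φ hr
  calc deformedQ m η φ r ^ 2 ≤ (3 * Q m r) ^ 2 := by gcongr; exact h.deformedQ_le hr
    _ = _ := by ring

lemma abs_deformedQ_sub_le (h : IsDeformationExponent m C η φ) (hr : 0 ≤ r) :
    |deformedQ m η φ r - Q m r| ≤ 3 * (C + 1) * η * r ^ 2 * Q m r := by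
  have hQ := Q_nonneg m hr
  rw [deformedQ_sub_eq, abs_mul, abs_of_nonneg hQ]
  calc Q m r * |Real.exp ((φ r - η * r ^ 2 / 2) / 2) - 1|
      ≤ Q m r * (3 * |(φ r - η * r ^ 2 / 2) / 2|) := by
        gcongr
        exact abs_exp_sub_one_le (h.sub_div_two_le_one hr)
    _ ≤ Q m r * (3 * ((C + 1) * η * r ^ 2)) := by gcongr; exact h.abs_sub_div_two_le hr
    _ = _ := by ring

lemma abs_deformedQ_sub_le_const_mul (h : IsDeformationExponent m C η φ) (hr : 0 ≤ r) :
    |deformedQ m η φ r - Q m r| ≤ 3 * Q m r := by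
  have hQ := Q_nonneg m hr
  have hle := h.deformedQ_le hr
  have hnonneg := deformedQ_nonneg m η φ hr
  rw [abs_le]
  constructor <;> linarith

theorem abs_sub_add_mode_le (h : IsDeformationExponent m C η φ) {D : ℝ} (hr : 0 ≤ r)
    (hD : |φ r - η * φ₁ r| ≤ D * (η ^ 2 * r ^ 4)) :
    |deformedQ m η φ r - Q m r + η * (((m : ℝ) + 1) * mode m φ₁ r)| ≤
      ((C + 1) ^ 2 + D) * (η ^ 2 * r ^ 4 * Q m r) := by
  have hQ := Q_nonneg m hr
  set x := (φ r - η * r ^ 2 / 2) / 2 with hx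
  have hsplit : deformedQ m η φ r - Q m r + η * (((m : ℝ) + 1) * mode m φ₁ r) =
      Q m r * ((Real.exp x - 1 - x) + (φ r - η * φ₁ r) / 2) := by
    rw [deformedQ_sub_eq, mode, hx]
    field_simp
    ring
  have hquad : |Real.exp x - 1 - x| ≤ (C + 1) ^ 2 * (η ^ 2 * r ^ 4) :=
    calc |Real.exp x - 1 - x| ≤ |x| ^ 2 := by
          rw [sq_abs]
          exact abs_exp_sub_one_sub_self_le (h.sub_div_two_le_one hr)
      _ ≤ ((C + 1) * η * r ^ 2) ^ 2 := by gcongr; exact h.abs_sub_div_two_le hr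
      _ = _ := by ring
  have hlin : |(φ r - η * φ₁ r) / 2| ≤ D * (η ^ 2 * r ^ 4) := by
    rw [abs_div, abs_two]
    linarith [abs_nonneg (φ r - η * φ₁ r)]
  rw [hsplit, abs_mul, abs_of_nonneg hQ]
  calc _ ≤ Q m r * ((C + 1) ^ 2 * (η ^ 2 * r ^ 4) + D * (η ^ 2 * r ^ 4)) := by
        gcongr
        exact (abs_add_le _ _).trans (add_le_add hquad hlin)
    _ = _ := by ring

lemma abs_deriv_deformedQ_le (h : IsDeformationExponent m C η φ) (hr : 0 < r) :
    |deriv (deformedQ m η φ) r| ≤ (3 * ((m : ℝ) + 1) / r + η * r / 2) * deformedQ m η φ r := by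
  have := deformedQ_pos m η φ hr
  rw [(h.hasDerivAt_deformedQ hr).deriv, abs_mul, abs_of_pos this]
  gcongr
  refine (abs_sub _ _).trans ?_
  rw [abs_div, abs_of_pos hr, abs_of_nonneg (by have := h.nonneg; positivity : 0 ≤ η * r / 2)]
  gcongr
  exact h.abs_angular_le hr.le

lemma abs_deriv_deformedQ_le_inv_mul (h : IsDeformationExponent m C η φ) (hr : 0 < r) :
    |deriv (deformedQ m η φ) r| ≤ 3 * (3 * ((m : ℝ) + 1) + 4) * (r⁻¹ * Q m r) := by
  have hQ := Q_pos m hr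
  have hη := h.nonneg
  set t := η * r ^ 2 / 8 with ht
  have ht0 : 0 ≤ t := by positivity
  have hexp : Real.exp (-t) ≤ 1 := Real.exp_le_one_iff.2 (by linarith)
  have hmulexp : t * Real.exp (-t) ≤ 1 := by
    rw [Real.exp_neg, ← div_eq_mul_inv, div_le_one (Real.exp_pos _)]
    linarith [Real.add_one_le_exp t]
  calc _ ≤ (3 * ((m : ℝ) + 1) / r + η * r / 2) * deformedQ m η φ r := h.abs_deriv_deformedQ_le hr
    _ ≤ (3 * ((m : ℝ) + 1) / r + η * r / 2) * (3 * Real.exp (-t) * Q m r) := by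
        gcongr
        exact h.deformedQ_le_exp_mul hr.le
    _ = 3 * (3 * ((m : ℝ) + 1) * Real.exp (-t) + 4 * (t * Real.exp (-t))) * (r⁻¹ * Q m r) := by
        rw [ht]
        field_simp
        ring
    _ ≤ 3 * (3 * ((m : ℝ) + 1) * 1 + 4 * 1) * (r⁻¹ * Q m r) := by gcongr
    _ = _ := by ring

theorem abs_iteratedDeriv_le (h : IsDeformationExponent m C η φ) {ℓ : ℕ} (hℓ : ℓ ≤ 1)
    (hr : 0 < r) :
    |iteratedDeriv ℓ (deformedQ m η φ) r| ≤
      3 * (3 * ((m : ℝ) + 1) + 4) * ((r ^ ℓ)⁻¹ * Q m r) := by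
  interval_cases ℓ
  · have := Q_pos m hr
    rw [iteratedDeriv_zero, abs_of_pos (deformedQ_pos m η φ hr), pow_zero, inv_one, one_mul]
    refine (h.deformedQ_le hr.le).trans ?_
    gcongr
    linarith [(m.cast_nonneg : (0 : ℝ) ≤ m)]
  · rw [iteratedDeriv_one, pow_one]
    exact h.abs_deriv_deformedQ_le_inv_mul hr

end IsDeformationExponent

end DeformedProfile

section OuterRegion

variable {m : ℕ} {C η : ℝ} {φ : ℝ → ℝ} {r : ℝ}

lemma Rad_pos (hη : 0 < η) : 0 < Rad 2 η := Real.rpow_pos_of_pos (by positivity) _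

lemma mul_Rad_sq (hη : 0 < η) : η * Rad 2 η ^ 2 = 1 / 2 := by
  rw [Rad, ← Real.rpow_natCast, ← Real.rpow_mul (by positivity), Nat.cast_ofNat,
    show (-(1 / 2) : ℝ) * 2 = -1 by norm_num, Real.rpow_neg_one]
  field_simp

namespace IsDeformationExponent

lemma two_mul_le_pow (h : IsDeformationExponent m C η φ) (hη : 0 < η) (hr : Rad 2 η ≤ r) :
    2 * ((m : ℝ) + 1) ≤ r ^ (2 * (m + 1)) := by
  have hRad : 2 * ((m : ℝ) + 1) ≤ Rad 2 η ^ 2 := by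
    refine le_of_mul_le_mul_left ?_ hη
    rw [mul_Rad_sq hη]
    nlinarith [h.const_ge, h.mul_le_one]
  have hsq : Rad 2 η ^ 2 ≤ r ^ 2 := pow_le_pow_left₀ (Rad_pos hη).le hr 2
  have hone : 1 ≤ r ^ 2 := by linarith [(m.cast_nonneg : (0 : ℝ) ≤ m)]
  rw [pow_mul]
  exact (hRad.trans hsq).trans (le_self_pow₀ hone (by omega))

lemma antitoneOn_mul_deformedP (h : IsDeformationExponent m C η φ) (hm : 1 ≤ m) (hη : 0 < η) :
    AntitoneOn (fun u => u * deformedP m φ u) (Ici (Rad 2 η)) := by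
  have hR := Rad_pos hη
  have hderiv : ∀ u, 0 < u → HasDerivAt (fun u => u * deformedP m φ u)
      ((1 + angular m (deformedQ m η φ) u) * deformedP m φ u) u := fun u hu => by
    refine ((hasDerivAt_id u).mul (h.hasDerivAt_deformedP hu)).congr_deriv ?_
    simp only [id]
    field_simp
  refine antitoneOn_of_hasDerivWithinAt_nonpos (convex_Ici _)
    (f' := fun u => (1 + angular m (deformedQ m η φ) u) * deformedP m φ u)
    (HasDerivAt.continuousOn fun u hu => hderiv u (hR.trans_le hu)) ?_ ?_ <;>
    rw [interior_Ici] <;> intro u hu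
  · exact (hderiv u (hR.trans hu)).hasDerivWithinAt
  · have hang := h.angular_le hm (hR.trans hu).le (h.two_mul_le_pow hη (le_of_lt hu))
    exact mul_nonpos_of_nonpos_of_nonneg (by linarith) (deformedP_pos m φ (hR.trans hu)).le

lemma mul_deformedP_le (h : IsDeformationExponent m C η φ) (hm : 1 ≤ m) (hη : 0 < η)
    (hr : Rad 2 η ≤ r) : r * deformedP m φ r ≤ Rad 2 η * (3 * Q m (Rad 2 η)) := by
  refine (h.antitoneOn_mul_deformedP hm hη self_mem_Ici hr hr).trans ?_
  have hR := Rad_pos hη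
  have hexp : Real.exp (φ (Rad 2 η) / 2) ≤ 3 := by
    refine (Real.exp_le_exp.2 ?_).trans Real.exp_one_lt_three.le
    linarith [le_of_abs_le (h.abs_le_one_add _ hR.le), mul_Rad_sq hη]
  have := Q_pos m hR
  simp only [deformedP, mul_comm (Q m _)]
  gcongr

lemma deformedP_le (h : IsDeformationExponent m C η φ) (hm : 1 ≤ m) (hη : 0 < η)
    (hr : Rad 2 η ≤ r) : deformedP m φ r ≤ 3 * Q m (Rad 2 η) := by
  have hR := Rad_pos hη
  refine le_of_mul_le_mul_left ?_ hR
  calc Rad 2 η * deformedP m φ r ≤ r * deformedP m φ r :=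
        mul_le_mul_of_nonneg_right hr (deformedP_pos m φ (hR.trans_le hr)).le
    _ ≤ _ := h.mul_deformedP_le hm hη hr

lemma abs_deriv_deformedQ_le_of_Rad_le (h : IsDeformationExponent m C η φ) (hm : 1 ≤ m)
    (hη : 0 < η) (hr : Rad 2 η ≤ r) :
    |deriv (deformedQ m η φ) r| ≤ 3 * (3 * ((m : ℝ) + 1) + 4) *
      ((Rad 2 η)⁻¹ * Q m (Rad 2 η) * Real.exp (-(η * r ^ 2 / 4))) := by
  have hP := h.deformedP_le hm hη hr
  have hrP := h.mul_deformedP_le hm hη hr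
  have hRsq := mul_Rad_sq hη
  have hR := Rad_pos hη
  set R := Rad 2 η
  have hr0 : 0 < r := hR.trans_le hr
  have hQ := Q_pos m hR
  have hP0 := deformedP_pos m φ hr0
  have hmain : (3 * ((m : ℝ) + 1) / r + η * r / 2) * deformedP m φ r ≤
      3 * (3 * ((m : ℝ) + 1) + 4) * (R⁻¹ * Q m R) :=
    calc _ = 3 * ((m : ℝ) + 1) / r * deformedP m φ r + η / 2 * (r * deformedP m φ r) := by ring
      _ ≤ 3 * ((m : ℝ) + 1) / R * (3 * Q m R) + η / 2 * (R * (3 * Q m R)) := by gcongr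
      _ = (9 * ((m : ℝ) + 1) + 3 / 2 * (η * R ^ 2)) * (R⁻¹ * Q m R) := by field_simp; ring
      _ ≤ _ := by rw [hRsq]; gcongr; linarith
  calc _ ≤ (3 * ((m : ℝ) + 1) / r + η * r / 2) * deformedQ m η φ r := h.abs_deriv_deformedQ_le hr0
    _ = (3 * ((m : ℝ) + 1) / r + η * r / 2) * deformedP m φ r * Real.exp (-(η * r ^ 2 / 4)) := by
        rw [deformedQ]
        ring
    _ ≤ 3 * (3 * ((m : ℝ) + 1) + 4) * (R⁻¹ * Q m R) * Real.exp (-(η * r ^ 2 / 4)) := by gcongr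
    _ = _ := by ring

lemma abs_iteratedDeriv_le_of_Rad_le (h : IsDeformationExponent m C η φ) (hm : 1 ≤ m)
    (hη : 0 < η) {ℓ : ℕ} (hℓ : ℓ ≤ 1) (hr : Rad 2 η ≤ r) :
    |iteratedDeriv ℓ (deformedQ m η φ) r| ≤ 3 * (3 * ((m : ℝ) + 1) + 4) *
      ((Rad 2 η ^ ℓ)⁻¹ * Q m (Rad 2 η) * Real.exp (-(η * r ^ 2 / 4))) := by
  have hR := Rad_pos hη
  interval_cases ℓ
  · have := Q_pos m hR
    rw [iteratedDeriv_zero, abs_of_pos (deformedQ_pos m η φ (hR.trans_le hr)), pow_zero, inv_one,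
      one_mul, deformedQ, mul_comm, ← mul_assoc]
    gcongr
    refine (h.deformedP_le hm hη hr).trans ?_
    gcongr
    linarith [(m.cast_nonneg : (0 : ℝ) ≤ m)]
  · rw [iteratedDeriv_one, pow_one]
    exact h.abs_deriv_deformedQ_le_of_Rad_le hm hη hr

theorem abs_iteratedDeriv_le_indicator_add (h : IsDeformationExponent m C η φ) (hm : 1 ≤ m)
    {ℓ : ℕ} (hℓ : ℓ ≤ 1) (hr : 0 < r) :
    |iteratedDeriv ℓ (deformedQ m η φ) r| ≤ 3 * (3 * ((m : ℝ) + 1) + 4) *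
      ((inner 2 η).indicator (fun s => (s ^ ℓ)⁻¹ * Q m s) r +
        (outer 2 η).indicator (fun s => (Rad 2 η ^ ℓ)⁻¹ * Q m (Rad 2 η) *
          Real.exp (-(η * s ^ 2 / 4))) r) := by
  by_cases hin : r ∈ inner 2 η
  · refine (h.abs_iteratedDeriv_le hℓ hr).trans (mul_le_mul_of_nonneg_left ?_ (by positivity))
    rw [indicator_of_mem hin]
    refine le_add_of_nonneg_right (indicator_nonneg (fun s hs => ?_) _)
    have hR := Rad_pos hs.1
    have := Q_pos m hR
    positivity
  · obtain ⟨hη, hR⟩ : r ∈ outer 2 η :=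
      ⟨h.nonneg.lt_of_ne fun hη => hin ⟨hr, Or.inl hη.symm⟩,
        le_of_not_ge fun hR => hin ⟨hr, Or.inr hR⟩⟩
    rw [indicator_of_notMem hin, indicator_of_mem (show r ∈ outer 2 η from ⟨hη, hR⟩), zero_add]
    exact h.abs_iteratedDeriv_le_of_Rad_le hm hη hℓ hR

end IsDeformationExponent

end OuterRegion

section Asymptotics

lemma isLittleO_log_of_hasDerivAt {f y : ℝ → ℝ} (hf : ∀ r > 0, HasDerivAt f (y r / r) r)
    (hy : Tendsto y atTop (𝓝 0)) : f =o[atTop] Real.log := by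
  refine isLittleO_iff.2 fun c hc => ?_
  obtain ⟨a, hya⟩ := eventually_atTop.1 ((hy.eventually (Metric.ball_mem_nhds 0 (half_pos hc))).and
    (eventually_ge_atTop 1))
  have ha : 1 ≤ a := (hya a le_rfl).2
  have hlarge := Real.tendsto_log_atTop.eventually_ge_atTop (|f a| / (c / 2))
  filter_upwards [hlarge, eventually_ge_atTop a] with r hlog hr
  have hpos : ∀ u ∈ Icc a r, 0 < u := fun u hu => by linarith [hu.1]
  have hbarrier : ∀ u ∈ Icc a r,
      HasDerivAt (fun u => |f a| + c / 2 * (Real.log u - Real.log a)) (c / 2 * u⁻¹) u :=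
    fun u hu => (((Real.hasDerivAt_log (hpos u hu).ne').sub_const _).const_mul _).const_add _
  have hgrowth : |f r| ≤ |f a| + c / 2 * (Real.log r - Real.log a) := by
    refine abs_le_of_abs_deriv_le hr (HasDerivAt.continuousOn fun u hu => hf u (hpos u hu))
      (HasDerivAt.continuousOn hbarrier) (fun u hu => hf u (hpos u (Ioo_subset_Icc_self hu)))
      (fun u hu => hbarrier u (Ioo_subset_Icc_self hu)) (by simp) fun u hu => ?_
    have hu0 := hpos u (Ioo_subset_Icc_self hu)
    have hyu : |y u| < c / 2 := by simpa using (hya u hu.1.le).1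
    rw [abs_div, abs_of_pos hu0, div_eq_mul_inv]
    gcongr
  have hloga : 0 ≤ Real.log a := Real.log_nonneg ha
  have hlogr : Real.log a ≤ Real.log r := Real.log_le_log (by linarith) hr
  rw [div_le_iff₀ (half_pos hc)] at hlog
  rw [Real.norm_eq_abs, Real.norm_of_nonneg (hloga.trans hlogr)]
  nlinarith

lemma tendsto_div_log_of_hasDerivAt {f y : ℝ → ℝ} {l : ℝ}
    (hf : ∀ r > 0, HasDerivAt f (y r / r) r) (hy : Tendsto y atTop (𝓝 l)) :
    Tendsto (fun r => f r / Real.log r) atTop (𝓝 l) := by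
  have hlo : (fun r => f r - l * Real.log r) =o[atTop] Real.log := by
    refine isLittleO_log_of_hasDerivAt (y := fun r => y r - l) (fun r hr => ?_)
      (by simpa using hy.sub_const l)
    exact ((hf r hr).sub ((Real.hasDerivAt_log hr.ne').const_mul l)).congr_deriv (by ring)
  refine tendsto_sub_nhds_zero_iff.1 (hlo.tendsto_div_nhds_zero.congr' ?_)
  filter_upwards [eventually_gt_atTop 1] with r hr
  have := (Real.log_pos hr).ne'
  field_simp

lemma isLittleO_of_mul_sub_eq {d M : ℝ → ℝ} {l : Filter ℝ} {k M₀ : ℝ} (hl : l ≤ 𝓝 0) (hk : 0 < k)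
    (hd : ∀ᶠ η in l, d η ≤ k / 2) (heq : ∀ᶠ η in l, d η * (k - d η) = η * M η)
    (hM : Tendsto M l (𝓝 M₀)) : (fun η => d η - η * (M₀ / k)) =o[l] fun η => η := by
  have hid : Tendsto (fun η : ℝ => η) l (𝓝 0) := tendsto_id.mono_left hl
  have hd0 : Tendsto d l (𝓝 0) := by
    refine squeeze_zero_norm' (a := fun η => |η * M η| / (k / 2)) ?_ ?_
    · filter_upwards [hd, heq] with η hdη heqη
      rw [Real.norm_eq_abs, le_div_iff₀ (half_pos hk), ← heqη, abs_mul]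
      gcongr
      exact le_abs.2 (Or.inl (by linarith))
    · simpa using ((hid.mul hM).abs).div_const (k / 2)
  have hquot : Tendsto (fun η => M η / (k - d η) - M₀ / k) l (𝓝 0) := by
    have hden : Tendsto (fun η => k - d η) l (𝓝 k) := by simpa using hd0.const_sub k
    simpa using (hM.div hden hk.ne').sub_const (M₀ / k)
  have hlo := (isBigO_refl (fun η : ℝ => η) l).mul_isLittleO ((isLittleO_one_iff ℝ).2 hquot)
  simp only [mul_one] at hlo
  refine hlo.congr' ?_ EventuallyEq.rfl
  filter_upwards [hd, heq] with η hdη heqη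
  have hne : k - d η ≠ 0 := by linarith
  rw [mul_sub, mul_div_assoc', ← heqη, mul_div_cancel_right₀ _ hne]

end Asymptotics

section Pohozaev

variable {m : ℕ} {η : ℝ} {u : ℝ → ℝ}

lemma hasDerivAt_angular (m : ℕ) (hu : Continuous u) (r : ℝ) :
    HasDerivAt (angular m u) (-(1 / 2) * (r * u r ^ 2)) r := by
  refine (((hasDerivAt_integral_zero (b := fun s => |u s| ^ 2 * s) (by fun_prop) r).const_mul
    (-(1 / 2))).const_add (m : ℝ)).congr_deriv ?_
  rw [sq_abs, mul_comm r]

lemma angular_zero (m : ℕ) (u : ℝ → ℝ) : angular m u 0 = m := by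
  simp [angular, Atheta]

lemma tendsto_angular (m : ℕ) (hu : SquareIntegrable u) :
    Tendsto (angular m u) atTop (𝓝 (-1 - theta m u)) := by
  have hlim := ((intervalIntegral_tendsto_integral_Ioi 0 hu tendsto_id).const_mul
    (-(1 / 2))).const_add (m : ℝ)
  have hlimit : -1 - theta m u = (m : ℝ) + -(1 / 2) * ∫ r in Ioi (0 : ℝ), |u r| ^ 2 * r := by
    rw [theta, planeIntegral]
    field_simp
    ring
  rwa [hlimit]

theorem pohozaev_identity (hu : Continuous u)
    (hderiv : ∀ r > 0, HasDerivAt u ((angular m u r / r - η * r / 2) * u r) r)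
    {r : ℝ} (hr : 0 ≤ r) :
    2 * (1 + angular m u r) ^ 2 + r ^ 2 * u r ^ 2 + η * ∫ s in (0 : ℝ)..r, s ^ 3 * u s ^ 2 =
      2 * ((m : ℝ) + 1) ^ 2 := by
  set E : ℝ → ℝ := fun r => 2 * (1 + angular m u r) ^ 2 + r ^ 2 * u r ^ 2 +
    η * ∫ s in (0 : ℝ)..r, s ^ 3 * u s ^ 2 with hE
  have hI := hasDerivAt_integral_zero (b := fun s => s ^ 3 * u s ^ 2) (by fun_prop)
  have hA : Continuous (angular m u) :=
    continuous_iff_continuousAt.2 fun r => (hasDerivAt_angular m hu r).continuousAt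
  have : Continuous fun r => ∫ s in (0 : ℝ)..r, s ^ 3 * u s ^ 2 :=
    continuous_iff_continuousAt.2 fun r => (hI r).continuousAt
  have hE' : ∀ s, 0 < s → HasDerivAt (fun s => E s - 2 * ((m : ℝ) + 1) ^ 2) 0 s := fun s hs => by
    refine ((((((hasDerivAt_angular m hu s).const_add 1).pow 2).const_mul 2).add
      ((hasDerivAt_pow 2 s).mul ((hderiv s hs).pow 2))).add
        ((hI s).const_mul η)).sub_const _ |>.congr_deriv ?_
    simp only [Pi.pow_apply]
    push_cast
    field_simp
    ring
  have hE0 : E 0 = 2 * ((m : ℝ) + 1) ^ 2 := by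
    simp only [hE, angular_zero, intervalIntegral.integral_same]
    ring
  have hconst : |E r - 2 * ((m : ℝ) + 1) ^ 2| ≤ 0 :=
    abs_le_of_abs_deriv_le (f := fun s => E s - 2 * ((m : ℝ) + 1) ^ 2) (g := fun _ => 0) hr
      (Continuous.continuousOn (by fun_prop)) continuousOn_const (fun s hs => hE' s hs.1)
      (fun s _ => hasDerivAt_const s 0) (by simp [hE0]) (by simp)
  exact sub_eq_zero.1 (abs_nonpos_iff.1 hconst)

theorem two_mul_theta_sq_add (hu : Continuous u)
    (hderiv : ∀ r > 0, HasDerivAt u ((angular m u r / r - η * r / 2) * u r) r)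
    (hL2 : SquareIntegrable u) (hmoment : IntegrableOn (fun r => r ^ 3 * u r ^ 2) (Ioi 0))
    (hdecay : Tendsto (fun r => r ^ 2 * u r ^ 2) atTop (𝓝 0)) :
    2 * theta m u ^ 2 + η * secondMoment u = 2 * ((m : ℝ) + 1) ^ 2 := by
  have hlim := (((((tendsto_angular m hL2).const_add 1).pow 2).const_mul 2).add hdecay).add
    ((intervalIntegral_tendsto_integral_Ioi 0 hmoment tendsto_id).const_mul η)
  have hconst := tendsto_nhds_unique hlim (tendsto_const_nhds.congr' (by
    filter_upwards [eventually_ge_atTop 0] with r hr using (pohozaev_identity hu hderiv hr).symm))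
  rw [← hconst, secondMoment]
  ring

end Pohozaev

section Decay

variable {m : ℕ} {C η η₀ : ℝ} {φ : ℝ → ℝ} {Φ : ℝ → ℝ → ℝ}

namespace IsDeformationExponent

lemma integrableOn_pow_mul_deformedQ_sq (h : IsDeformationExponent m C η φ) {p : ℕ}
    (hp : p ≤ 2 * m + 2) :
    IntegrableOn (fun r => r ^ p * deformedQ m η φ r ^ 2) (Ioi (0 : ℝ)) := by
  have hc := continuous_deformedQ (m := m) (η := η) h.continuous
  refine Integrable.mono' ((integrableOn_pow_mul_Q_sq m hp).const_mul 9)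
    (Continuous.aestronglyMeasurable (by fun_prop)) ?_
  refine (ae_restrict_mem measurableSet_Ioi).mono fun r (hr : 0 < r) => ?_
  rw [Real.norm_of_nonneg (by positivity), mul_left_comm]
  gcongr
  exact h.deformedQ_sq_le hr.le

lemma squareIntegrable (h : IsDeformationExponent m C η φ) :
    SquareIntegrable (deformedQ m η φ) := by
  refine (h.integrableOn_pow_mul_deformedQ_sq (p := 1) (by omega)).congr_fun (fun r _ => ?_)
    measurableSet_Ioi
  simp only [pow_one, sq_abs, mul_comm]

lemma abs_sub_sq_mul_le (h : IsDeformationExponent m C η φ) {r : ℝ} (hr : 0 ≤ r) :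
    |deformedQ m η φ r - Q m r| ^ 2 * r ≤ 9 * (r ^ 1 * Q m r ^ 2) :=
  calc _ ≤ (3 * Q m r) ^ 2 * r := by gcongr; exact h.abs_deformedQ_sub_le_const_mul hr
    _ = _ := by ring

lemma squareIntegrable_sub (h : IsDeformationExponent m C η φ) :
    SquareIntegrable fun r => deformedQ m η φ r - Q m r := by
  have hQ := Q_continuous m
  have hc := continuous_deformedQ (m := m) (η := η) h.continuous
  refine Integrable.mono' ((integrableOn_pow_mul_Q_sq m (p := 1) (by omega)).const_mul 9)
    (Continuous.aestronglyMeasurable (by fun_prop)) ?_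
  refine (ae_restrict_mem measurableSet_Ioi).mono fun r (hr : 0 < r) => ?_
  rw [Real.norm_of_nonneg (by positivity)]
  exact h.abs_sub_sq_mul_le hr.le

lemma tendsto_log_deformedP (h : IsDeformationExponent m C η φ) :
    Tendsto (fun r => Real.log (deformedP m φ r) / Real.log r) atTop
      (𝓝 (-1 - theta m (deformedQ m η φ))) := by
  refine tendsto_div_log_of_hasDerivAt (fun r hr => ?_) (tendsto_angular m h.squareIntegrable)
  have hP := deformedP_pos m φ hr
  refine ((h.hasDerivAt_deformedP hr).log hP.ne').congr_deriv ?_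
  field_simp

lemma half_le_theta (h : IsDeformationExponent m C η φ) (hm : 1 ≤ m) :
    1 / 2 ≤ theta m (deformedQ m η φ) := by
  have hle : -1 - theta m (deformedQ m η φ) ≤ -3 / 2 := by
    refine le_of_tendsto (tendsto_angular m h.squareIntegrable) ?_
    have hpow : Tendsto (fun r : ℝ => r ^ (2 * (m + 1))) atTop atTop := tendsto_pow_atTop (by omega)
    filter_upwards [hpow.eventually_ge_atTop (2 * ((m : ℝ) + 1)), eventually_ge_atTop 0]
      with r hfar hr
    exact h.angular_le hm hr hfar
  linarith

lemma tendsto_sq_mul_deformedQ_sq (h : IsDeformationExponent m C η φ) :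
    Tendsto (fun r => r ^ 2 * deformedQ m η φ r ^ 2) atTop (𝓝 0) := by
  have hinv : Tendsto (fun r : ℝ => 9 * (8 * ((m : ℝ) + 1) ^ 2 * (r ^ 1)⁻¹)) atTop (𝓝 0) := by
    simpa using ((tendsto_inv_atTop_zero (𝕜 := ℝ)).const_mul (8 * ((m : ℝ) + 1) ^ 2)).const_mul 9
  refine squeeze_zero' (Eventually.of_forall fun r => by positivity) ?_ hinv
  filter_upwards [eventually_ge_atTop 1] with r hr
  calc r ^ 2 * deformedQ m η φ r ^ 2 ≤ r ^ 2 * (9 * Q m r ^ 2) := by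
        gcongr
        exact h.deformedQ_sq_le (zero_le_one.trans hr)
    _ = 9 * (r ^ 2 * Q m r ^ 2) := by ring
    _ ≤ _ := mul_le_mul_of_nonneg_left (pow_mul_Q_sq_le m 2 1 (by omega) hr) (by norm_num)

lemma two_mul_theta_sq_add (h : IsDeformationExponent m C η φ) (hm : 1 ≤ m) :
    2 * theta m (deformedQ m η φ) ^ 2 + η * secondMoment (deformedQ m η φ) =
      2 * ((m : ℝ) + 1) ^ 2 :=
  CSS.two_mul_theta_sq_add (continuous_deformedQ h.continuous) (fun _ => h.hasDerivAt_deformedQ)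
    h.squareIntegrable (h.integrableOn_pow_mul_deformedQ_sq (by omega))
    h.tendsto_sq_mul_deformedQ_sq

lemma secondMoment_pos (h : IsDeformationExponent m C η φ) (hm : 1 ≤ m) :
    0 < secondMoment (deformedQ m η φ) := by
  have hpos : ∀ r ∈ Ioi (0 : ℝ), 0 < r ^ 3 * deformedQ m η φ r ^ 2 := fun r hr =>
    mul_pos (pow_pos hr 3) (pow_pos (deformedQ_pos m η φ hr) 2)
  have hsupport : Ioi 0 ⊆ Function.support fun r => r ^ 3 * deformedQ m η φ r ^ 2 :=
    fun r hr => (hpos r hr).ne'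
  rw [secondMoment, setIntegral_pos_iff_support_of_nonneg_ae
    ((ae_restrict_mem measurableSet_Ioi).mono fun r hr => (hpos r hr).le)
    (h.integrableOn_pow_mul_deformedQ_sq (by omega)),
    inter_eq_self_of_subset_right hsupport]
  simp

lemma theta_lt (h : IsDeformationExponent m C η φ) (hm : 1 ≤ m) (hη : 0 < η) :
    theta m (deformedQ m η φ) < (m : ℝ) + 1 := by
  have hid := h.two_mul_theta_sq_add hm
  have hpos := mul_pos hη (h.secondMoment_pos hm)
  exact lt_of_pow_lt_pow_left₀ 2 (by positivity) (by linarith)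

end IsDeformationExponent

lemma eventually_mem_Icc_nhdsGT (hη₀ : 0 < η₀) : ∀ᶠ η in 𝓝[>] (0 : ℝ), η ∈ Icc 0 η₀ :=
  mem_of_superset (Ioc_mem_nhdsGT hη₀) Ioc_subset_Icc_self

lemma tendsto_deformedQ (hη₀ : 0 < η₀)
    (hΦ : ∀ η ∈ Icc 0 η₀, IsDeformationExponent m C η (Φ η)) {r : ℝ} (hr : 0 ≤ r) :
    Tendsto (fun η => deformedQ m η (Φ η) r) (𝓝[>] 0) (𝓝 (Q m r)) := by
  rw [tendsto_iff_norm_sub_tendsto_zero]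
  have hzero : Tendsto (fun η : ℝ => 3 * (C + 1) * η * r ^ 2 * Q m r) (𝓝[>] 0) (𝓝 0) := by
    have hc : Continuous fun η : ℝ => 3 * (C + 1) * η * r ^ 2 * Q m r := by fun_prop
    simpa using (hc.tendsto 0).mono_left nhdsWithin_le_nhds
  refine squeeze_zero' (Eventually.of_forall fun η => norm_nonneg _) ?_ hzero
  filter_upwards [eventually_mem_Icc_nhdsGT hη₀] with η hη
  exact (hΦ η hη).abs_deformedQ_sub_le hr

lemma tendsto_secondMoment (hm : 1 ≤ m) (hη₀ : 0 < η₀)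
    (hΦ : ∀ η ∈ Icc 0 η₀, IsDeformationExponent m C η (Φ η)) :
    Tendsto (fun η => secondMoment (deformedQ m η (Φ η))) (𝓝[>] 0) (𝓝 (secondMoment (Q m))) := by
  have hev := eventually_mem_Icc_nhdsGT hη₀
  refine tendsto_integral_filter_of_dominated_convergence (fun r => 9 * (r ^ 3 * Q m r ^ 2)) ?_ ?_
    ((integrableOn_pow_mul_Q_sq m (by omega)).const_mul 9) ?_
  · filter_upwards [hev] with η hη
    have := continuous_deformedQ (m := m) (η := η) (hΦ η hη).continuous
    exact Continuous.aestronglyMeasurable (by fun_prop)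
  · filter_upwards [hev] with η hη
    refine (ae_restrict_mem measurableSet_Ioi).mono fun r (hr : 0 < r) => ?_
    rw [Real.norm_of_nonneg (by positivity), mul_left_comm]
    gcongr
    exact (hΦ η hη).deformedQ_sq_le hr.le
  · exact (ae_restrict_mem measurableSet_Ioi).mono fun r (hr : 0 < r) =>
      ((tendsto_deformedQ hη₀ hΦ hr.le).pow 2).const_mul _

lemma planeIntegral_sq (m : ℕ) (u : ℝ → ℝ) :
    planeIntegral (fun r => |u r| ^ 2) = 4 * Real.pi * (theta m u + ((m : ℝ) + 1)) := by
  rw [theta]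
  field_simp
  ring

lemma planeIntegral_mul_sq (u : ℝ → ℝ) :
    planeIntegral (fun r => |r * u r| ^ 2) = 2 * Real.pi * secondMoment u := by
  rw [planeIntegral, secondMoment]
  congr 2 with r
  rw [sq_abs]
  ring

lemma theta_Q (m : ℕ) : theta m (Q m) = (m : ℝ) + 1 := by
  have hmass : ∫ r in Ioi (0 : ℝ), |Q m r| ^ 2 * r = 4 * ((m : ℝ) + 1) := by
    simpa only [sq_abs, mul_comm _ (_ ^ 2), massQ_zero, sub_zero] using
      integral_Ioi_mul_Q_sq m le_rfl
  rw [theta, planeIntegral, hmass]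
  field_simp
  ring

theorem theta_deformedQ_isLittleO (hm : 1 ≤ m) (hη₀ : 0 < η₀)
    (hΦ : ∀ η ∈ Icc 0 η₀, IsDeformationExponent m C η (Φ η)) :
    (fun η => theta m (deformedQ m η (Φ η)) - (((m : ℝ) + 1) - η / (8 * Real.pi * ((m : ℝ) + 1)) *
      planeIntegral (fun r => |r * Q m r| ^ 2))) =o[𝓝[>] 0] fun η => η := by
  have hev := eventually_mem_Icc_nhdsGT hη₀
  refine (isLittleO_of_mul_sub_eq (d := fun η => (m : ℝ) + 1 - theta m (deformedQ m η (Φ η)))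
    (k := 2 * ((m : ℝ) + 1)) nhdsWithin_le_nhds (by positivity) ?_ ?_
    ((tendsto_secondMoment hm hη₀ hΦ).div_const 2)).neg_left.congr_left fun η => ?_
  · filter_upwards [hev] with η hη
    linarith [(hΦ η hη).half_le_theta hm]
  · filter_upwards [hev] with η hη
    linear_combination (-1 / 2) * (hΦ η hη).two_mul_theta_sq_add hm
  · rw [planeIntegral_mul_sq]
    field_simp
    ring

theorem planeIntegral_deformedQ_sq_isLittleO (hm : 1 ≤ m) (hη₀ : 0 < η₀)
    (hΦ : ∀ η ∈ Icc 0 η₀, IsDeformationExponent m C η (Φ η)) :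
    (fun η => planeIntegral (fun r => |deformedQ m η (Φ η) r| ^ 2) -
      (planeIntegral (fun r => |Q m r| ^ 2) - η / (2 * ((m : ℝ) + 1)) *
        planeIntegral (fun r => |r * Q m r| ^ 2))) =o[𝓝[>] 0] fun η => η := by
  refine ((theta_deformedQ_isLittleO hm hη₀ hΦ).const_mul_left (4 * Real.pi)).congr_left fun η => ?_
  rw [planeIntegral_sq m (deformedQ m η (Φ η)), planeIntegral_sq m (Q m), theta_Q]
  field_simp
  ring

theorem decayExponent_isLittleO (hm : 1 ≤ m) (hη₀ : 0 < η₀)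
    (hΦ : ∀ η ∈ Icc 0 η₀, IsDeformationExponent m C η (Φ η)) :
    (fun η => -1 - theta m (deformedQ m η (Φ η)) - (-((m : ℝ) + 2) +
      η / (8 * Real.pi * ((m : ℝ) + 1)) * planeIntegral (fun r => |r * Q m r| ^ 2)))
        =o[𝓝[>] 0] fun η => η :=
  (theta_deformedQ_isLittleO hm hη₀ hΦ).neg_left.congr_left fun η => by ring

end Decay

section L2Estimate

variable {m : ℕ} {C η R : ℝ} {φ : ℝ → ℝ}

lemma l2norm_le_of_integral_le {f : ℝ → ℝ} {K a : ℝ} (ha : 0 ≤ a)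
    (h : ∫ r in Ioi (0 : ℝ), |f r| ^ 2 * r ≤ K * a ^ 2) :
    l2norm f ≤ √(2 * Real.pi * K) * a := by
  rw [l2norm, planeIntegral]
  calc √(2 * Real.pi * ∫ r in Ioi (0 : ℝ), |f r| ^ 2 * r) ≤ √(2 * Real.pi * K * a ^ 2) := by
        rw [mul_assoc (2 * Real.pi)]
        gcongr
    _ = _ := by rw [Real.sqrt_mul' _ (sq_nonneg a), Real.sqrt_sq ha]

lemma integral_Ioi_inv_pow (hR : 0 < R) {j : ℕ} (hj : j ≠ 0) :
    ∫ r in Ioi R, (r ^ (j + 1))⁻¹ = (R ^ j)⁻¹ / j := by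
  have hj' : (0 : ℝ) < j := by exact_mod_cast Nat.pos_of_ne_zero hj
  have hrpow : ∫ r in Ioi R, (r ^ (j + 1))⁻¹ = ∫ r in Ioi R, r ^ (-(j : ℝ) - 1) := by
    refine setIntegral_congr_fun measurableSet_Ioi fun r hr => ?_
    rw [← neg_add', Real.rpow_neg (hR.trans hr).le]
    norm_cast
  rw [hrpow, integral_Ioi_rpow_of_lt (by linarith) hR, sub_add_cancel, Real.rpow_neg hR.le,
    Real.rpow_natCast, neg_div_neg_eq]

lemma integral_pow_five_mul_Q_sq_le (hm : 1 ≤ m) (hR : 1 ≤ R) :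
    ∫ r in (0 : ℝ)..R, r ^ 5 * Q m r ^ 2 ≤
      (∫ r in (0 : ℝ)..1, r ^ 5 * Q m r ^ 2) + 8 * ((m : ℝ) + 1) ^ 2 * Real.log R := by
  have hQ := Q_continuous m
  have hc : Continuous fun r => r ^ 5 * Q m r ^ 2 := by fun_prop
  have h0 : (0 : ℝ) ∉ uIcc 1 R := notMem_uIcc_of_lt one_pos (one_pos.trans_le hR)
  have hlog : ∫ r in (1 : ℝ)..R, 8 * ((m : ℝ) + 1) ^ 2 * (r ^ 1)⁻¹ =
      8 * ((m : ℝ) + 1) ^ 2 * Real.log R := by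
    simp only [intervalIntegral.integral_const_mul, pow_one, integral_inv h0, div_one]
  rw [← intervalIntegral.integral_add_adjacent_intervals (hc.intervalIntegrable 0 1)
    (hc.intervalIntegrable 1 R), ← hlog]
  refine add_le_add_right (intervalIntegral.integral_mono_on hR (hc.intervalIntegrable _ _) ?_
    fun r hr => pow_mul_Q_sq_le m 5 1 (by omega) hr.1) _
  simp only [pow_one]
  exact (intervalIntegral.intervalIntegrable_inv (fun r hr hr0 => h0 (hr0 ▸ hr))
    continuousOn_id).const_mul _

namespace IsDeformationExponent

lemma abs_sub_sq_mul_le_pow_five (h : IsDeformationExponent m C η φ) {r : ℝ} (hr : 0 ≤ r) :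
    |deformedQ m η φ r - Q m r| ^ 2 * r ≤ 9 * (C + 1) ^ 2 * η ^ 2 * (r ^ 5 * Q m r ^ 2) :=
  calc _ ≤ (3 * (C + 1) * η * r ^ 2 * Q m r) ^ 2 * r := by
        gcongr
        exact h.abs_deformedQ_sub_le hr
    _ = _ := by ring

theorem integral_sub_sq_le (h : IsDeformationExponent m C η φ) (hm : 2 ≤ m) :
    ∫ r in Ioi (0 : ℝ), |deformedQ m η φ r - Q m r| ^ 2 * r ≤
      9 * (C + 1) ^ 2 * (∫ r in Ioi (0 : ℝ), r ^ 5 * Q m r ^ 2) * η ^ 2 := by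
  rw [mul_right_comm, ← integral_const_mul]
  exact setIntegral_mono_on h.squareIntegrable_sub
    ((integrableOn_pow_mul_Q_sq m (p := 5) (by omega)).const_mul _) measurableSet_Ioi
    fun r hr => h.abs_sub_sq_mul_le_pow_five (le_of_lt hr)

lemma integral_Ioi_sub_sq_le (h : IsDeformationExponent m C η φ) (hm : 1 ≤ m) (hR : 1 ≤ R) :
    ∫ r in Ioi R, |deformedQ m η φ r - Q m r| ^ 2 * r ≤ 18 * ((m : ℝ) + 1) ^ 2 * (R ^ 4)⁻¹ := by
  have hR0 : 0 < R := one_pos.trans_le hR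
  calc _ ≤ ∫ r in Ioi R, 9 * (8 * ((m : ℝ) + 1) ^ 2) * (r ^ 5)⁻¹ := by
        refine setIntegral_mono_on (h.squareIntegrable_sub.mono_set (Ioi_subset_Ioi hR0.le))
          ((integrableOn_inv_pow hR0 (by norm_num)).const_mul _) measurableSet_Ioi
          fun r (hr : R < r) => ?_
        linarith [h.abs_sub_sq_mul_le (hR0.trans hr).le,
          pow_mul_Q_sq_le m 1 5 (by omega) (hR.trans hr.le)]
    _ = _ := by
        rw [integral_const_mul, integral_Ioi_inv_pow hR0 four_ne_zero, Nat.cast_ofNat]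
        ring

lemma integral_sub_sq_le_add_log (h : IsDeformationExponent m C η φ) (hm : 1 ≤ m) (hR : 1 ≤ R) :
    ∫ r in Ioi (0 : ℝ), |deformedQ m η φ r - Q m r| ^ 2 * r ≤
      9 * (C + 1) ^ 2 * η ^ 2 *
        ((∫ r in (0 : ℝ)..1, r ^ 5 * Q m r ^ 2) + 8 * ((m : ℝ) + 1) ^ 2 * Real.log R) +
      18 * ((m : ℝ) + 1) ^ 2 * (R ^ 4)⁻¹ := by
  have hQ := Q_continuous m
  have hc := continuous_deformedQ (m := m) (η := η) h.continuous
  have hR0 : 0 ≤ R := zero_le_one.trans hR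
  have hint := h.squareIntegrable_sub
  rw [← intervalIntegral.integral_interval_add_Ioi hint (hint.mono_set (Ioi_subset_Ioi hR0))]
  refine add_le_add ?_ (h.integral_Ioi_sub_sq_le hm hR)
  calc _ ≤ ∫ r in (0 : ℝ)..R, 9 * (C + 1) ^ 2 * η ^ 2 * (r ^ 5 * Q m r ^ 2) :=
        intervalIntegral.integral_mono_on hR0 (Continuous.intervalIntegrable (by fun_prop) _ _)
          (Continuous.intervalIntegrable (by fun_prop) _ _)
          fun r hr => h.abs_sub_sq_mul_le_pow_five hr.1
    _ ≤ _ := by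
        rw [intervalIntegral.integral_const_mul]
        gcongr
        exact integral_pow_five_mul_Q_sq_le hm hR

theorem integral_sub_sq_le_log (h : IsDeformationExponent m C η φ) (hm : 1 ≤ m) (hη : 0 < η)
    (hη' : η ≤ 1 / 3) :
    ∫ r in Ioi (0 : ℝ), |deformedQ m η φ r - Q m r| ^ 2 * r ≤
      (9 * (C + 1) ^ 2 * ((∫ r in (0 : ℝ)..1, r ^ 5 * Q m r ^ 2) + 8 * ((m : ℝ) + 1) ^ 2) +
        18 * ((m : ℝ) + 1) ^ 2) * (η ^ 2 * |Real.log η|) := by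
  have hlog : Real.log η ≤ -1 := by
    rw [Real.log_le_iff_le_exp hη, Real.exp_neg]
    exact hη'.trans (by rw [one_div]; gcongr; exact Real.exp_one_lt_three.le)
  have habs : |Real.log η| = -Real.log η := abs_of_nonpos (by linarith)
  -- The two bounds on `Q^η - Q` balance at this radius.
  set R := (√η)⁻¹ with hRdef
  have hR : 1 ≤ R := by
    rw [hRdef, one_le_inv₀ (Real.sqrt_pos.2 hη), Real.sqrt_le_one]
    linarith
  have hR4 : (R ^ 4)⁻¹ = η ^ 2 := by
    rw [hRdef, inv_pow, inv_inv, pow_mul _ 2 2, Real.sq_sqrt hη.le]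
  have hlogR : Real.log R = |Real.log η| / 2 := by
    rw [hRdef, Real.log_inv, Real.log_sqrt hη.le, habs]
    ring
  have hI : 0 ≤ ∫ r in (0 : ℝ)..1, r ^ 5 * Q m r ^ 2 :=
    intervalIntegral.integral_nonneg zero_le_one fun r hr =>
      mul_nonneg (pow_nonneg hr.1 5) (sq_nonneg _)
  set I := ∫ r in (0 : ℝ)..1, r ^ 5 * Q m r ^ 2
  set L := |Real.log η|
  have hL : 1 ≤ L := by linarith
  calc _ ≤ 9 * (C + 1) ^ 2 * η ^ 2 * (I + 8 * ((m : ℝ) + 1) ^ 2 * (L / 2)) +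
        18 * ((m : ℝ) + 1) ^ 2 * η ^ 2 := hlogR ▸ hR4 ▸ h.integral_sub_sq_le_add_log hm hR
    _ ≤ 9 * (C + 1) ^ 2 * η ^ 2 * (I * L + 8 * ((m : ℝ) + 1) ^ 2 * L) +
        18 * ((m : ℝ) + 1) ^ 2 * (η ^ 2 * L) := by
      gcongr
      · exact le_mul_of_one_le_right hI hL
      · linarith
      · exact le_mul_of_one_le_right (sq_nonneg η) hL
    _ = _ := by ring

lemma deformedQ_eq_Q (h : IsDeformationExponent m C 0 φ) {r : ℝ} (hr : 0 ≤ r) :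
    deformedQ m 0 φ r = Q m r :=
  sub_eq_zero.1 (abs_nonpos_iff.1 (by simpa using h.abs_deformedQ_sub_le hr))

lemma deformedP_eq_Q (h : IsDeformationExponent m C 0 φ) {r : ℝ} (hr : 0 ≤ r) :
    deformedP m φ r = Q m r := by
  simpa [deformedQ] using h.deformedQ_eq_Q hr

lemma integral_sub_sq_eq_zero (h : IsDeformationExponent m C 0 φ) :
    ∫ r in Ioi (0 : ℝ), |deformedQ m 0 φ r - Q m r| ^ 2 * r = 0 :=
  setIntegral_eq_zero_of_forall_eq_zero fun r hr => by simp [h.deformedQ_eq_Q (le_of_lt hr)]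

end IsDeformationExponent

theorem exists_l2norm_le (hm : 1 ≤ m) (C : ℝ) : ∃ K, ∀ η φ, η ≤ 1 / 3 →
    IsDeformationExponent m C η φ → l2norm (fun r => deformedQ m η φ r - Q m r) ≤
      K * (if m = 1 then η * √|Real.log η| else η) := by
  by_cases h_one : m = 1
  · simp only [if_pos h_one]
    refine ⟨√(2 * Real.pi * (9 * (C + 1) ^ 2 *
      ((∫ r in (0 : ℝ)..1, r ^ 5 * Q m r ^ 2) + 8 * ((m : ℝ) + 1) ^ 2) +
        18 * ((m : ℝ) + 1) ^ 2)), fun η φ hη' h =>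
      l2norm_le_of_integral_le (mul_nonneg h.nonneg (Real.sqrt_nonneg _)) ?_⟩
    rw [mul_pow, Real.sq_sqrt (abs_nonneg _)]
    rcases h.nonneg.eq_or_lt with rfl | hη
    · simpa using h.integral_sub_sq_eq_zero.le
    · exact h.integral_sub_sq_le_log hm hη hη'
  · simp only [if_neg h_one]
    exact ⟨_, fun η φ _ h => l2norm_le_of_integral_le h.nonneg (h.integral_sub_sq_le (by omega))⟩

end L2Estimate

theorem exists_isDeformationExponent_family {m : ℕ} (hm : 1 ≤ m) :
    ∃ (C η₀ : ℝ) (Φ : ℝ → ℝ → ℝ), 0 < η₀ ∧ η₀ ≤ 1 / 3 ∧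
      ∀ η ∈ Icc 0 η₀, IsDeformationExponent m C η (Φ η) := by
  obtain ⟨C, η₀, hη₀, h⟩ := exists_isDeformationExponent hm
  choose! Φ hΦ using h
  exact ⟨C, min η₀ (1 / 3), Φ, lt_min hη₀ (by norm_num), min_le_right _ _,
    fun η hη => hΦ η hη.1 (hη.2.trans (min_le_left _ _))⟩

end CSS

end

theorem proposition4p3 (m : ℕ) (hm : 1 ≤ m) :
    ∃ ρ : ℝ → ℝ, CSS.IsGeneralizedMode m ρ ∧
    ∃ (B ηs : ℝ) (Qη Pη : ℝ → ℝ → ℝ), 1 < B ∧ 0 < ηs ∧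
      -- smooth real profiles on (0,∞), with P positive and Q in L²
      (∀ η ∈ Set.Icc 0 ηs,
        ContDiffOn ℝ ∞ (Qη η) (Set.Ioi 0) ∧ ContDiffOn ℝ ∞ (Pη η) (Set.Ioi 0) ∧
        (∀ r > 0, 0 < Pη η r) ∧
        CSS.SquareIntegrable (Qη η) ∧
        CSS.SquareIntegrable (fun r => Qη η r - CSS.Q m r)) ∧
      -- equations
      (∀ η ∈ Set.Icc 0 ηs, ∀ r > 0,
        CSS.Dplus m (Qη η) (Pη η) r = 0 ∧
        Qη η r = Real.exp (-(η * r ^ 2 / 4)) * Pη η r) ∧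
      (∀ r > 0, Qη 0 r = CSS.Q m r ∧ Pη 0 r = CSS.Q m r) ∧
      -- refined uniform bounds
      (∃ C : ℝ, ∀ ℓ : ℕ, ℓ ≤ 1 → ∀ η ∈ Set.Icc 0 ηs, ∀ r > 0,
        |iteratedDeriv ℓ (Qη η) r| ≤
          C * ((CSS.inner B η).indicator (fun s => (s ^ ℓ)⁻¹ * CSS.Q m s) r +
            (CSS.outer B η).indicator (fun s => (CSS.Rad B η ^ ℓ)⁻¹ * CSS.Q m (CSS.Rad B η) *
              Real.exp (-(η * s ^ 2 / 4))) r)) ∧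
      -- uniform bounds
      (∃ C : ℝ, ∀ ℓ : ℕ, ℓ ≤ 1 → ∀ r > 0, ∀ η ∈ Set.Icc 0 ηs,
        |iteratedDeriv ℓ (Qη η) r| ≤ C * ((r ^ ℓ)⁻¹ * CSS.Q m r)) ∧
      -- differentiability in η
      (∃ C : ℝ, ∀ η ∈ Set.Icc 0 ηs, ∀ r ∈ CSS.inner B η,
        |Qη η r - CSS.Q m r + η * (((m : ℝ) + 1) * ρ r)| ≤ C * (η ^ 2 * r ^ 4 * CSS.Q m r)) ∧
      -- subcritical mass
      ((fun η => CSS.planeIntegral (fun r => |Qη η r| ^ 2) -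
          (CSS.planeIntegral (fun r => |CSS.Q m r| ^ 2) -
            η / (2 * ((m : ℝ) + 1)) * CSS.planeIntegral (fun r => |r * CSS.Q m r| ^ 2)))
        =o[𝓝[>] (0 : ℝ)] fun η => η) ∧
      ((fun η => CSS.theta m (Qη η) -
          (((m : ℝ) + 1) - η / (8 * Real.pi * ((m : ℝ) + 1)) *
            CSS.planeIntegral (fun r => |r * CSS.Q m r| ^ 2)))
        =o[𝓝[>] (0 : ℝ)] fun η => η) ∧
      -- decay of P
      (∃ d : ℝ → ℝ,
        (∀ η ∈ Set.Icc 0 ηs,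
          Tendsto (fun r => Real.log (Pη η r) / Real.log r) atTop (𝓝 (d η))) ∧
        ((fun η => d η - (-((m : ℝ) + 2) + η / (8 * Real.pi * ((m : ℝ) + 1)) *
            CSS.planeIntegral (fun r => |r * CSS.Q m r| ^ 2)))
          =o[𝓝[>] (0 : ℝ)] fun η => η) ∧
        (∀ η ∈ Set.Ioc 0 ηs, -((m : ℝ) + 2) < d η)) ∧
      -- L² difference
      (∃ C : ℝ, ∀ η ∈ Set.Icc 0 ηs,
        CSS.l2norm (fun r => Qη η r - CSS.Q m r) ≤
          C * (if m = 1 then η * √|Real.log η| else η)) := by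
  obtain ⟨φ₁, C₁, hφ₁, hφ₁_le⟩ := CSS.exists_isFirstVariation m
  obtain ⟨C, ηs, Φ, hηs, hηs', hΦ⟩ := CSS.exists_isDeformationExponent_family hm
  obtain ⟨K, hK⟩ := CSS.exists_l2norm_le hm C
  exact ⟨CSS.mode m φ₁, CSS.isGeneralizedMode_mode hφ₁ hφ₁_le,
    2, ηs, fun η => CSS.deformedQ m η (Φ η), fun η => CSS.deformedP m (Φ η), one_lt_two, hηs,
    fun η hη => ⟨(hΦ η hη).contDiffOn_deformedQ, (hΦ η hη).contDiffOn_deformedP,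
      fun r hr => CSS.deformedP_pos m _ hr, (hΦ η hη).squareIntegrable,
      (hΦ η hη).squareIntegrable_sub⟩,
    fun η hη r hr => ⟨(hΦ η hη).Dplus_deformedP hr, rfl⟩,
    fun r hr => ⟨(hΦ 0 ⟨le_rfl, hηs.le⟩).deformedQ_eq_Q (le_of_lt hr),
      (hΦ 0 ⟨le_rfl, hηs.le⟩).deformedP_eq_Q (le_of_lt hr)⟩,
    ⟨_, fun ℓ hℓ η hη r hr => (hΦ η hη).abs_iteratedDeriv_le_indicator_add hm hℓ hr⟩,
    ⟨_, fun ℓ hℓ r hr η hη => (hΦ η hη).abs_iteratedDeriv_le hℓ hr⟩,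
    ⟨_, fun η hη r hr => (hΦ η hη).abs_sub_add_mode_le hr.1.le
      ((hΦ η hη).abs_sub_firstVariation_le hφ₁ hr.1.le)⟩,
    CSS.planeIntegral_deformedQ_sq_isLittleO hm hηs hΦ, CSS.theta_deformedQ_isLittleO hm hηs hΦ,
    ⟨fun η => -1 - CSS.theta m (CSS.deformedQ m η (Φ η)),
      fun η hη => (hΦ η hη).tendsto_log_deformedP, CSS.decayExponent_isLittleO hm hηs hΦ,
      fun η hη => by linarith [(hΦ η (Set.Ioc_subset_Icc_self hη)).theta_lt hm hη.1]⟩,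
    ⟨K, fun η hη => hK η (Φ η) (hη.2.trans hηs') (hΦ η hη)⟩⟩
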